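/- Let $\psi_1,\psi_2,\psi_3>0$, $F_1>0$, $\tau\in\mathbb R$, $\mu_{1,1},\mu_{2,1}\in\mathbb R$ and $\mu_{1,2},\mu_{2,2}>0$. (In the double random feature model with nonlinear activations $\sigma_1,\sigma_2$ and ridge parameter $\lambda$, these are $\psi_j=\lim N_j/d$ for $j=1,2$, $\psi_3=\lim n/d$, the limiting signal norm $F_1$, the noise level $\tau$, and the spherical moments $\mu_{j,1}=\mathbb E[G\sigma_j(G)]$, $\mu_{j,2}^2=\mathbb E[\sigma_j(G)^2]-\mathbb E[\sigma_j(G)]^2-\mu_{j,1}^2$ with $G\sim N(0,1)$; $\mu_{j,2}>0$ says that $\sigma_j$ is not almost everywhere equal to an affine function.) Let $\nu=(\nu_1,\nu_2,\nu_3):\mathbb C_+\to\mathbb C_+^3$ be the unique analytic function on the open upper half plane that satisfies, for every $\xi\in\mathbb C_+$, with $D=1-\mu_{1,1}^2\nu_1\nu_3-\mu_{2,1}^2\nu_2\nu_3$, $$\nu_1\Big(-\xi-\mu_{1,2}^2\nu_3-\frac{\mu_{1,1}^2\nu_3}{D}\Big)=\psi_1,\qquad \nu_2\Big(-\xi-\mu_{2,2}^2\nu_3-\frac{\mu_{2,1}^2\nu_3}{D}\Big)=\psi_2,$$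 $$\nu_3\Big(-\xi-\mu_{1,2}^2\nu_1-\mu_{2,2}^2\nu_2-\frac{\mu_{1,1}^2\nu_1+\mu_{2,1}^2\nu_2}{D}\Big)=\psi_3,$$ and for which there is $\xi_0>0$ with $|\nu_j(\xi)|\le 2\psi_j/\xi_0$ for $j=1,2,3$ whenever $\operatorname{Im}\xi\ge\xi_0$. For $\lambda>0$ put $\nu_j^*=\nu_j(\sqrt\lambda\, i)$, $M_N=\nu_1^*\mu_{1,1}^2+\nu_2^*\mu_{2,1}^2$, $M_D=\nu_3^*M_N-1$, let $H$ be the symmetric matrix $$H=\begin{bmatrix}-\frac{\nu_3^{*2}\mu_{1,1}^4}{M_D^2}+\frac{\psi_1}{\nu_1^{*2}}&-\frac{\nu_3^{*2}\mu_{1,1}^2\mu_{2,1}^2}{M_D^2}&-\frac{\mu_{1,1}^2}{M_D^2}-\mu_{1,2}^2\\ *&-\frac{\nu_3^{*2}\mu_{2,1}^4}{M_D^2}+\frac{\psi_2}{\nu_2^{*2}}&-\frac{\mu_{2,1}^2}{M_D^2}-\mu_{2,2}^2\\ *&*&-\frac{M_N^2}{M_D^2}+\frac{\psi_3}{\nu_3^{*2}}\end{bmatrix},$$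 let $$V=\begin{bmatrix}\mu_{1,2}^2&0&\frac{\mu_{1,1}^2}{M_D^2}&\frac{\nu_3^{*2}\mu_{1,1}^2}{M_D^2}\\ \mu_{2,2}^2&0&\frac{\mu_{2,1}^2}{M_D^2}&\frac{\nu_3^{*2}\mu_{2,1}^2}{M_D^2}\\ 0&1&\frac{M_N^2}{M_D^2}&\frac{1}{M_D^2}\end{bmatrix},$$ put $L=V^{\mathsf T}H^{-1}V$, and let the asymptotic excess risk be the (real) number $$\mathcal R=F_1^2\Big(\frac1{M_D^2}+L_{3,4}+L_{1,4}\Big)+\tau^2\big(L_{2,3}+L_{1,2}\big).$$ Then: 1. If $(\psi_1+\psi_2)/\psi_3<1$, then $\lim_{\lambda\to0^+}\mathcal R$ exists and is finite. 2. If $(\psi_1+\psi_2)/\psi_3=1$, then $\lim_{\lambda\to0^+}\mathcal R=+\infty$. 3. If $1<(\psi_1+\psi_2)/\psi_3<1+\psi_2/\psi_1$, then $\lim_{\lambda\to0^+}\mathcal R$ exists and is finite for all $\mu_{2,1}\in\mathbb R$, $\mu_{2,2}>0$, and $\liminf_{\mu_{2,1}\to0,\ \mu_{2,2}\to0^+}\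 \lim_{\lambda\to0^+}\mathcal R<+\infty$. 4. If $(\psi_1+\psi_2)/\psi_3=1+\psi_2/\psi_1$, then $\lim_{\lambda\to0^+}\mathcal R$ exists and is finite for all $\mu_{2,1}\in\mathbb R$, $\mu_{2,2}>0$, and $\lim_{\mu_{2,1}\to0,\ \mu_{2,2}\to0^+}\ \lim_{\lambda\to0^+}\mathcal R=+\infty$. -/

import Mathlib

open Filter Topology

/-- The parameters of a double random feature model that enter the asymptotic risk: the limits
`ψ₁ = lim N₁ / d`, `ψ₂ = lim N₂ / d`, `ψ₃ = lim n / d`, and the spherical moments `μⱼ₁`, `μⱼ₂` of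
the two activation functions (`μⱼ₁ = E[G σⱼ(G)]`, `μⱼ₂² = E[σⱼ(G)²] - E[σⱼ(G)]² - μⱼ₁²` for a
standard normal `G`). -/
structure DRFMParams where
  ψ₁ : ℝ
  ψ₂ : ℝ
  ψ₃ : ℝ
  μ₁₁ : ℝ
  μ₁₂ : ℝ
  μ₂₁ : ℝ
  μ₂₂ : ℝ

namespace DRFMParams

/-- The open upper half plane `ℂ₊`. -/
def upperHalf : Set ℂ := {z | 0 < z.im}

/-- `(n₁, n₂, n₃)` solves the `ν`-system at `ξ`. -/
def NuSystem (P : DRFMParams) (ξ n₁ n₂ n₃ : ℂ) : Prop :=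
  n₁ * (-ξ - (P.μ₁₂ : ℂ) ^ 2 * n₃
      - (P.μ₁₁ : ℂ) ^ 2 * n₃ / (1 - (P.μ₂₁ : ℂ) ^ 2 * n₂ * n₃ - (P.μ₁₁ : ℂ) ^ 2 * n₁ * n₃))
    = (P.ψ₁ : ℂ) ∧
  n₂ * (-ξ - (P.μ₂₂ : ℂ) ^ 2 * n₃
      - (P.μ₂₁ : ℂ) ^ 2 * n₃ / (1 - (P.μ₁₁ : ℂ) ^ 2 * n₁ * n₃ - (P.μ₂₁ : ℂ) ^ 2 * n₂ * n₃))
    = (P.ψ₂ : ℂ) ∧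
  n₃ * (-ξ - (P.μ₁₂ : ℂ) ^ 2 * n₁ - (P.μ₂₂ : ℂ) ^ 2 * n₂
      - ((P.μ₁₁ : ℂ) ^ 2 * n₁ + (P.μ₂₁ : ℂ) ^ 2 * n₂)
        / (1 - (P.μ₁₁ : ℂ) ^ 2 * n₁ * n₃ - (P.μ₂₁ : ℂ) ^ 2 * n₂ * n₃))
    = (P.ψ₃ : ℂ)

/-- The properties that determine `ν = (ν₁, ν₂, ν₃) : ℂ₊ → ℂ₊³` (indices `0, 1, 2` here; values
off `ℂ₊` play no role): analyticity, the `ν`-system at every `ξ ∈ ℂ₊`, and a bound for large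
imaginary part. -/
structure IsNu (P : DRFMParams) (ν : ℂ → Fin 3 → ℂ) : Prop where
  analytic : ∀ j, DifferentiableOn ℂ (fun ξ => ν ξ j) upperHalf
  mapsTo : ∀ ξ ∈ upperHalf, ∀ j, ν ξ j ∈ upperHalf
  system : ∀ ξ ∈ upperHalf, P.NuSystem ξ (ν ξ 0) (ν ξ 1) (ν ξ 2)
  bound : ∃ ξ₀ : ℝ, 0 < ξ₀ ∧ ∀ ξ : ℂ, ξ₀ ≤ ξ.im →
    ‖ν ξ 0‖ ≤ 2 * P.ψ₁ / ξ₀ ∧ ‖ν ξ 1‖ ≤ 2 * P.ψ₂ / ξ₀ ∧ ‖ν ξ 2‖ ≤ 2 * P.ψ₃ / ξ₀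

/-- The function `ν` with these properties (an arbitrary function if there were none). -/
noncomputable def nu (P : DRFMParams) : ℂ → Fin 3 → ℂ :=
  Classical.epsilon P.IsNu

/-- `ν* = ν(√λ · i)`. -/
noncomputable def nuStar (P : DRFMParams) (lam : ℝ) : Fin 3 → ℂ :=
  P.nu ((Real.sqrt lam : ℂ) * Complex.I)

/-- `M_N = ν₁* μ₁₁² + ν₂* μ₂₁²`. -/
noncomputable def MN (P : DRFMParams) (lam : ℝ) : ℂ :=
  P.nuStar lam 0 * (P.μ₁₁ : ℂ) ^ 2 + P.nuStar lam 1 * (P.μ₂₁ : ℂ) ^ 2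

/-- `M_D = ν₃* M_N - 1`. -/
noncomputable def MD (P : DRFMParams) (lam : ℝ) : ℂ :=
  P.nuStar lam 2 * P.MN lam - 1

/-- The symmetric matrix `H`. -/
noncomputable def matH (P : DRFMParams) (lam : ℝ) : Matrix (Fin 3) (Fin 3) ℂ :=
  let n := P.nuStar lam
  let D := P.MD lam
  let a : ℂ := (P.μ₁₁ : ℂ) ^ 2
  let b : ℂ := (P.μ₂₁ : ℂ) ^ 2
  let c : ℂ := (P.μ₁₂ : ℂ) ^ 2
  let e : ℂ := (P.μ₂₂ : ℂ) ^ 2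
  !![-(n 2 ^ 2 * a ^ 2 / D ^ 2) + P.ψ₁ / n 0 ^ 2, -(n 2 ^ 2 * a * b / D ^ 2), -(a / D ^ 2) - c;
     -(n 2 ^ 2 * a * b / D ^ 2), -(n 2 ^ 2 * b ^ 2 / D ^ 2) + P.ψ₂ / n 1 ^ 2, -(b / D ^ 2) - e;
     -(a / D ^ 2) - c, -(b / D ^ 2) - e, -(P.MN lam ^ 2 / D ^ 2) + P.ψ₃ / n 2 ^ 2]

/-- The matrix `V`. -/
noncomputable def matV (P : DRFMParams) (lam : ℝ) : Matrix (Fin 3) (Fin 4) ℂ :=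
  let n := P.nuStar lam
  let D := P.MD lam
  let a : ℂ := (P.μ₁₁ : ℂ) ^ 2
  let b : ℂ := (P.μ₂₁ : ℂ) ^ 2
  let c : ℂ := (P.μ₁₂ : ℂ) ^ 2
  let e : ℂ := (P.μ₂₂ : ℂ) ^ 2
  !![c, 0, a / D ^ 2, n 2 ^ 2 * a / D ^ 2;
     e, 0, b / D ^ 2, n 2 ^ 2 * b / D ^ 2;
     0, 1, P.MN lam ^ 2 / D ^ 2, 1 / D ^ 2]

/-- The matrix `L = Vᵀ H⁻¹ V`; its entry `L_{i,j}` is `matL (i - 1) (j - 1)`. -/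
noncomputable def matL (P : DRFMParams) (lam : ℝ) : Matrix (Fin 4) (Fin 4) ℂ :=
  (P.matV lam).transpose * (P.matH lam)⁻¹ * P.matV lam

/-- The asymptotic excess risk
`F₁² (1 / M_D² + L_{3,4} + L_{1,4}) + τ² (L_{2,3} + L_{1,2})`. For `λ > 0` the numbers `νⱼ*` are
purely imaginary, so the expression is real; `.re` only changes its type. -/
noncomputable def risk (P : DRFMParams) (F₁ τ lam : ℝ) : ℝ :=
  ((F₁ : ℂ) ^ 2 * (1 / P.MD lam ^ 2 + P.matL lam 2 3 + P.matL lam 0 3)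
    + (τ : ℂ) ^ 2 * (P.matL lam 1 2 + P.matL lam 0 1)).re

end DRFMParams

/-! The `ν`-system is assembled from positive combinations, the inversion `z ↦ -z⁻¹` and the
translation by `ξ`. In the upper half plane the first two do not increase the hyperbolic distance,
and the translation contracts it strictly at bounded height. So `nuStep` contracts on horodiscs,
which gives `exists_isNu` and `nuSystem_unique`. Uniqueness forces `ν(√λ i)` to be fixed by the
reflection `z ↦ -conj z`, hence `νⱼ* = i xⱼ` with `xⱼ > 0`.

Put `tⱼ = √λ xⱼ`, `p = x₁x₃`, `q = x₂x₃`. A diagonal rescaling turns `-H` into the Laplacian of a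
weighted triangle with killing rates `tⱼ` (`realH_eq`). Its determinant and adjugate have
nonnegative terms only, so the risk is a sum of nonnegative terms, and the determinant degenerates
in the limit only if all killing rates vanish. These rates satisfy `t₁ + t₂ - t₃ = ψ₁ + ψ₂ - ψ₃`,
while `t₁t₃ = λp` and `t₂t₃ = λq` tend to `0`. Below the threshold `t₃` survives (`tendsto_under`),
above it `t₁ + t₂` survives (`tendsto_over`), and at the threshold nothing does
(`tendsto_threshold`). Convergence of `p`, `q` and, above the threshold, of `k = λ/t₃` is
compactness together with uniqueness for the limiting equations `Balance`, which rests on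
monotonicity in one scalar, `D = 1 + ap + bq`.

Above the threshold the limiting rates are `kp`, `kq`, `0`. If `ψ₁ < ψ₃` and `μ₂₁ = 0`, the second
activation enters the risk only through `eq`, which stays in a compact set of positive numbers
(`exists_reducedRisk_le`). If `ψ₁ = ψ₃`, the balance forces `k² = O(b + e)`, and the weights at the
second vertex are at most `kp`. Vertices 1 and 3 are then left almost without killing, the
determinant is `O(kp)`, and the risk is at least a constant over `kp`
(`le_reducedRisk_second_threshold`). -/

namespace DRFMParams

/-! ### Hyperbolic distance in the upper half plane -/

/-- `‖z - w‖ ≤ r √(im z) √(im w)`: a bound on a hyperbolic distance in the upper half plane. -/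
def HypClose (r : ℝ) (z w : ℂ) : Prop :=
  ‖z - w‖ ≤ r * (Real.sqrt z.im * Real.sqrt w.im)

namespace HypClose

variable {r : ℝ} {z w z' w' : ℂ}

/-- Cauchy–Schwarz for the vectors `(√x, √x')` and `(√y, √y')`. -/
lemma sqrt_mul_add_le {x y x' y' : ℝ} (hx : 0 ≤ x) (hy : 0 ≤ y) (hx' : 0 ≤ x') (hy' : 0 ≤ y') :
    Real.sqrt x * Real.sqrt y + Real.sqrt x' * Real.sqrt y' ≤
      Real.sqrt (x + x') * Real.sqrt (y + y') := by
  rw [← Real.sqrt_mul (add_nonneg hx hx')]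
  apply Real.le_sqrt_of_sq_le
  have h1 := Real.sq_sqrt hx
  have h2 := Real.sq_sqrt hy
  have h3 := Real.sq_sqrt hx'
  have h4 := Real.sq_sqrt hy'
  generalize Real.sqrt x = s at *
  generalize Real.sqrt y = t at *
  generalize Real.sqrt x' = s' at *
  generalize Real.sqrt y' = t' at *
  subst h1 h2 h3 h4
  nlinarith [sq_nonneg (s * t' - s' * t)]

lemma add (hr : 0 ≤ r) (h : HypClose r z w) (h' : HypClose r z' w') (hz : 0 ≤ z.im)
    (hw : 0 ≤ w.im) (hz' : 0 ≤ z'.im) (hw' : 0 ≤ w'.im) : HypClose r (z + z') (w + w') := by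
  unfold HypClose at *
  calc ‖z + z' - (w + w')‖ = ‖(z - w) + (z' - w')‖ := by ring_nf
    _ ≤ ‖z - w‖ + ‖z' - w'‖ := norm_add_le _ _
    _ ≤ r * (Real.sqrt z.im * Real.sqrt w.im + Real.sqrt z'.im * Real.sqrt w'.im) := by
        rw [mul_add]; exact add_le_add h h'
    _ ≤ _ := by
        rw [Complex.add_im, Complex.add_im]
        exact mul_le_mul_of_nonneg_left (sqrt_mul_add_le hz hw hz' hw') hr

lemma smul {t : ℝ} (ht : 0 ≤ t) (h : HypClose r z w) : HypClose r (t * z) (t * w) := by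
  unfold HypClose at *
  rw [← mul_sub, norm_mul, Complex.norm_real, Real.norm_of_nonneg ht, Complex.im_ofReal_mul,
    Complex.im_ofReal_mul, Real.sqrt_mul ht, Real.sqrt_mul ht]
  have := Real.mul_self_sqrt ht
  calc t * ‖z - w‖ ≤ t * (r * (Real.sqrt z.im * Real.sqrt w.im)) :=
        mul_le_mul_of_nonneg_left h ht
    _ = (Real.sqrt t * Real.sqrt t) * (r * (Real.sqrt z.im * Real.sqrt w.im)) := by rw [this]
    _ = _ := by ring

/-- The inversion is a hyperbolic isometry: both sides of the bound pick up the factor `1 / (‖z‖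
‖w‖)`. -/
lemma neg_inv (hz : z ≠ 0) (hw : w ≠ 0) (h : HypClose r z w) : HypClose r (-z⁻¹) (-w⁻¹) := by
  unfold HypClose at *
  have hz' : 0 < ‖z‖ := norm_pos_iff.2 hz
  have hw' : 0 < ‖w‖ := norm_pos_iff.2 hw
  have e1 : -z⁻¹ - -w⁻¹ = (z - w) * (z⁻¹ * w⁻¹) := by field_simp; ring
  have im : ∀ u : ℂ, u ≠ 0 → Real.sqrt (-u⁻¹).im = Real.sqrt u.im * ‖u‖⁻¹ := by
    intro u hu
    rw [Complex.neg_im, Complex.inv_im, neg_div, neg_neg, Complex.normSq_eq_norm_sq,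
      Real.sqrt_div' _ (by positivity), Real.sqrt_sq (norm_nonneg _), div_eq_mul_inv]
  rw [e1, norm_mul, norm_mul, norm_inv, norm_inv, im z hz, im w hw]
  calc ‖z - w‖ * (‖z‖⁻¹ * ‖w‖⁻¹) ≤
      r * (Real.sqrt z.im * Real.sqrt w.im) * (‖z‖⁻¹ * ‖w‖⁻¹) :=
        mul_le_mul_of_nonneg_right h (by positivity)
    _ = _ := by ring

/-- Moving up by `ξ` contracts the hyperbolic distance, uniformly below height `K`. -/
lemma contract {K η : ℝ} {ξ : ℂ} (hr : 0 ≤ r) (hη : 0 < η) (hξ : η ≤ ξ.im) (h : HypClose r z w)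
    (hz : 0 ≤ z.im) (hw : 0 ≤ w.im) (hzK : z.im ≤ K) (hwK : w.im ≤ K) :
    HypClose (K / (K + η) * r) (ξ + z) (ξ + w) := by
  unfold HypClose at *
  have hK : 0 ≤ K := hz.trans hzK
  have hK' : 0 < K + η := by linarith
  have key : ∀ x : ℝ, 0 ≤ x → x ≤ K → x ≤ K / (K + η) * (ξ.im + x) := by
    intro x hx hxK
    rw [div_mul_eq_mul_div, le_div_iff₀ hK']
    nlinarith
  have hq : 0 ≤ K / (K + η) := by positivity
  have hs : Real.sqrt z.im * Real.sqrt w.im ≤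
      K / (K + η) * (Real.sqrt (ξ.im + z.im) * Real.sqrt (ξ.im + w.im)) := by
    calc Real.sqrt z.im * Real.sqrt w.im ≤ Real.sqrt (K / (K + η) * (ξ.im + z.im)) *
          Real.sqrt (K / (K + η) * (ξ.im + w.im)) := by
          gcongr
          · exact key _ hz hzK
          · exact key _ hw hwK
      _ = (Real.sqrt (K / (K + η)) * Real.sqrt (K / (K + η))) *
          (Real.sqrt (ξ.im + z.im) * Real.sqrt (ξ.im + w.im)) := by
          rw [Real.sqrt_mul hq, Real.sqrt_mul hq]; ring
      _ = _ := by rw [Real.mul_self_sqrt hq]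
  rw [Complex.add_im, Complex.add_im, add_sub_add_left_eq_sub]
  calc ‖z - w‖ ≤ r * (Real.sqrt z.im * Real.sqrt w.im) := h
    _ ≤ r * (K / (K + η) * (Real.sqrt (ξ.im + z.im) * Real.sqrt (ξ.im + w.im))) :=
        mul_le_mul_of_nonneg_left hs hr
    _ = _ := by ring

end HypClose

/-! ### The fixed-point map of the `ν`-system and its contraction -/

/-- The self-energies of the `ν`-system, with `a = μ₁₁²`, `b = μ₂₁²`, `c = μ₁₂²`, `e = μ₂₂²`. -/
noncomputable def selfEnergy (a b c e : ℝ) (n : Fin 3 → ℂ) : Fin 3 → ℂ :=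
  ![c * n 2 + a * (n 2 / (1 - (a * n 0 + b * n 1) * n 2)),
    e * n 2 + b * (n 2 / (1 - (a * n 0 + b * n 1) * n 2)),
    c * n 0 + e * n 1 + (a * n 0 + b * n 1) / (1 - (a * n 0 + b * n 1) * n 2)]

/-- The map whose fixed points are the solutions of the `ν`-system. -/
noncomputable def nuStep (a b c e : ℝ) (ψ : Fin 3 → ℝ) (ξ : ℂ) (n : Fin 3 → ℂ) : Fin 3 → ℂ :=
  fun j => ψ j * (-(ξ + selfEnergy a b c e n j)⁻¹)

lemma neg_inv_im_nonneg {z : ℂ} (hz : 0 ≤ z.im) : 0 ≤ (-z⁻¹).im := by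
  rw [Complex.neg_im, Complex.inv_im, neg_div, neg_neg]
  exact div_nonneg hz (Complex.normSq_nonneg _)

lemma ne_zero_of_im_pos {z : ℂ} (hz : 0 < z.im) : z ≠ 0 := by
  rintro rfl; simp at hz

lemma neg_inv_im_pos {z : ℂ} (hz : 0 < z.im) : 0 < (-z⁻¹).im := by
  rw [Complex.neg_im, Complex.inv_im, neg_div, neg_neg]
  exact div_pos hz (Complex.normSq_pos.2 (ne_zero_of_im_pos hz))

section Resolvent

variable {S z : ℂ}

lemma add_neg_inv_ne_zero (hS : 0 ≤ S.im) (hz : 0 < z.im) : S + -z⁻¹ ≠ 0 :=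
  ne_zero_of_im_pos (by rw [Complex.add_im]; linarith [neg_inv_im_pos hz])

lemma one_sub_mul_ne_zero (hS : 0 ≤ S.im) (hz : 0 < z.im) : 1 - S * z ≠ 0 := by
  have h := add_neg_inv_ne_zero hS hz
  have hz0 := ne_zero_of_im_pos hz
  intro h0
  apply h
  field_simp
  linear_combination -h0

/-- Writes the quotient by sums and inversions alone, so that the rules for `HypClose` apply to it.
-/
lemma div_one_sub_mul (hS : 0 ≤ S.im) (hz : 0 < z.im) :
    z / (1 - S * z) = -(S + -z⁻¹)⁻¹ := by
  have h := add_neg_inv_ne_zero hS hz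
  have h' := one_sub_mul_ne_zero hS hz
  have hz0 := ne_zero_of_im_pos hz
  have e1 : S + -z⁻¹ = -((1 - S * z) / z) := by field_simp; ring
  rw [e1, inv_neg, neg_neg, inv_div]

lemma div_one_sub_mul' (hS : 0 < S.im) (hz : 0 < z.im) :
    S / (1 - S * z) = -(z + -S⁻¹)⁻¹ := by
  rw [mul_comm, div_one_sub_mul hz.le hS]

lemma div_one_sub_mul_im_pos (hS : 0 ≤ S.im) (hz : 0 < z.im) : 0 < (z / (1 - S * z)).im := by
  rw [div_one_sub_mul hS hz]
  apply neg_inv_im_pos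
  rw [Complex.add_im]; linarith [neg_inv_im_pos hz]

end Resolvent

section Step

variable {a b c e : ℝ} {ψ : Fin 3 → ℝ} {n m : Fin 3 → ℂ} {ξ : ℂ} {η : ℝ}

lemma weight_im_nonneg (ha : 0 ≤ a) (hb : 0 ≤ b) (hn : ∀ j, 0 < (n j).im) :
    0 ≤ (a * n 0 + b * n 1 : ℂ).im := by
  rw [Complex.add_im, Complex.im_ofReal_mul, Complex.im_ofReal_mul]
  have := (hn 0).le
  have := (hn 1).le
  positivity

/-- `div_one_sub_mul'` inverts the weight `a n₀ + b n₁`, so the case in which it vanishes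
identically has to be split off. -/
lemma weight_cases (ha : 0 ≤ a) (hb : 0 ≤ b) :
    (a = 0 ∧ b = 0) ∨ ∀ n : Fin 3 → ℂ, (∀ j, 0 < (n j).im) → 0 < (a * n 0 + b * n 1 : ℂ).im := by
  rcases ha.eq_or_lt with h | h
  · rcases hb.eq_or_lt with h' | h'
    · exact Or.inl ⟨h.symm, h'.symm⟩
    · right
      intro n hn
      rw [Complex.add_im, Complex.im_ofReal_mul, Complex.im_ofReal_mul]
      have := (hn 0).le
      have := hn 1
      positivity
  · right
    intro n hn
    rw [Complex.add_im, Complex.im_ofReal_mul, Complex.im_ofReal_mul]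
    have := hn 0
    have := (hn 1).le
    positivity

lemma weight_div_im_nonneg (ha : 0 ≤ a) (hb : 0 ≤ b) (hn : ∀ j, 0 < (n j).im) :
    0 ≤ ((a * n 0 + b * n 1) / (1 - (a * n 0 + b * n 1) * n 2) : ℂ).im := by
  rcases weight_cases ha hb with ⟨rfl, rfl⟩ | h
  · simp
  · rw [div_one_sub_mul' (h n hn) (hn 2)]
    apply neg_inv_im_nonneg
    rw [Complex.add_im]
    linarith [neg_inv_im_pos (h n hn), hn 2]

lemma selfEnergy_im_nonneg (ha : 0 ≤ a) (hb : 0 ≤ b) (hc : 0 ≤ c) (he : 0 ≤ e)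
    (hn : ∀ j, 0 < (n j).im) (j : Fin 3) : 0 ≤ (selfEnergy a b c e n j).im := by
  have hS := weight_im_nonneg ha hb hn
  have h2 := (div_one_sub_mul_im_pos hS (hn 2)).le
  have h3 := weight_div_im_nonneg ha hb hn
  have := (hn 0).le
  have := (hn 1).le
  have := (hn 2).le
  fin_cases j
  · simp only [selfEnergy, Fin.zero_eta, Matrix.cons_val_zero, Complex.add_im,
      Complex.im_ofReal_mul]
    positivity
  · simp only [selfEnergy, Fin.mk_one, Matrix.cons_val_one, Matrix.cons_val_zero, Complex.add_im,
      Complex.im_ofReal_mul]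
    positivity
  · simp only [selfEnergy, Fin.reduceFinMk, Matrix.cons_val, Complex.add_im,
      Complex.im_ofReal_mul]
    positivity

lemma selfEnergy_hypClose {r : ℝ} (hr : 0 ≤ r) (ha : 0 ≤ a) (hb : 0 ≤ b) (hc : 0 ≤ c) (he : 0 ≤ e)
    (hn : ∀ j, 0 < (n j).im) (hm : ∀ j, 0 < (m j).im) (h : ∀ j, HypClose r (n j) (m j))
    (j : Fin 3) : HypClose r (selfEnergy a b c e n j) (selfEnergy a b c e m j) := by
  have im : ∀ {t : ℝ} {k : Fin 3 → ℂ} (i), 0 ≤ t → (∀ j, 0 < (k j).im) → 0 ≤ (t * k i : ℂ).im := by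
    intro t k i ht hk
    rw [Complex.im_ofReal_mul]
    exact mul_nonneg ht (hk i).le
  have hSn := weight_im_nonneg ha hb hn
  have hSm := weight_im_nonneg ha hb hm
  have hS : HypClose r (a * n 0 + b * n 1) (a * m 0 + b * m 1) :=
    ((h 0).smul ha).add hr ((h 1).smul hb) (im 0 ha hn) (im 0 ha hm) (im 1 hb hn) (im 1 hb hm)
  have hR : HypClose r (n 2 / (1 - (a * n 0 + b * n 1) * n 2))
      (m 2 / (1 - (a * m 0 + b * m 1) * m 2)) := by
    rw [div_one_sub_mul hSn (hn 2), div_one_sub_mul hSm (hm 2)]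
    apply HypClose.neg_inv (add_neg_inv_ne_zero hSn (hn 2)) (add_neg_inv_ne_zero hSm (hm 2))
    exact hS.add hr ((h 2).neg_inv (ne_zero_of_im_pos (hn 2)) (ne_zero_of_im_pos (hm 2)))
      hSn hSm (neg_inv_im_pos (hn 2)).le (neg_inv_im_pos (hm 2)).le
  have hRn := (div_one_sub_mul_im_pos hSn (hn 2)).le
  have hRm := (div_one_sub_mul_im_pos hSm (hm 2)).le
  have hT : HypClose r ((a * n 0 + b * n 1) / (1 - (a * n 0 + b * n 1) * n 2))
      ((a * m 0 + b * m 1) / (1 - (a * m 0 + b * m 1) * m 2)) := by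
    rcases weight_cases ha hb with ⟨rfl, rfl⟩ | hpos
    · simp [HypClose]
    · have pn := hpos n hn
      have pm := hpos m hm
      rw [div_one_sub_mul' pn (hn 2), div_one_sub_mul' pm (hm 2)]
      apply HypClose.neg_inv (add_neg_inv_ne_zero (hn 2).le pn) (add_neg_inv_ne_zero (hm 2).le pm)
      exact (h 2).add hr (hS.neg_inv (ne_zero_of_im_pos pn) (ne_zero_of_im_pos pm))
        (hn 2).le (hm 2).le (neg_inv_im_pos pn).le (neg_inv_im_pos pm).le
  have imR : ∀ {t : ℝ} {z : ℂ}, 0 ≤ t → 0 ≤ z.im → 0 ≤ (t * z).im := by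
    intro t z ht hz
    rw [Complex.im_ofReal_mul]; exact mul_nonneg ht hz
  fin_cases j
  · exact ((h 2).smul hc).add hr (hR.smul ha) (im 2 hc hn) (im 2 hc hm) (imR ha hRn) (imR ha hRm)
  · exact ((h 2).smul he).add hr (hR.smul hb) (im 2 he hn) (im 2 he hm) (imR hb hRn) (imR hb hRm)
  · refine (((h 0).smul hc).add hr ((h 1).smul he) (im 0 hc hn) (im 0 hc hm) (im 1 he hn)
      (im 1 he hm)).add hr hT ?_ ?_ (weight_div_im_nonneg ha hb hn) (weight_div_im_nonneg ha hb hm)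
    · exact weight_im_nonneg hc he hn
    · exact weight_im_nonneg hc he hm

lemma add_selfEnergy_im (ha : 0 ≤ a) (hb : 0 ≤ b) (hc : 0 ≤ c) (he : 0 ≤ e)
    (hη : η ≤ ξ.im) (hn : ∀ j, 0 < (n j).im) (j : Fin 3) :
    η ≤ (ξ + selfEnergy a b c e n j).im := by
  rw [Complex.add_im]
  linarith [selfEnergy_im_nonneg ha hb hc he hn j]

/-- The horodisc condition that holds after one step. -/
def InHorodisc (ψ : Fin 3 → ℝ) (η : ℝ) (n : Fin 3 → ℂ) : Prop :=
  ∀ j, 0 < (n j).im ∧ η * ‖n j‖ ^ 2 ≤ ψ j * (n j).im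

/-- For `Im w ≥ η` one has `Im (-w⁻¹) = Im w / ‖w‖² ≥ η ‖w⁻¹‖²`. -/
lemma nuStep_inHorodisc (ha : 0 ≤ a) (hb : 0 ≤ b) (hc : 0 ≤ c) (he : 0 ≤ e) (hψ : ∀ j, 0 < ψ j)
    (hη : 0 < η) (hξ : η ≤ ξ.im) (hn : ∀ j, 0 < (n j).im) :
    InHorodisc ψ η (nuStep a b c e ψ ξ n) := by
  intro j
  have h := add_selfEnergy_im ha hb hc he hξ hn j
  unfold nuStep
  set w := ξ + selfEnergy a b c e n j
  have hw := ne_zero_of_im_pos (hη.trans_le h)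
  have hw' : 0 < ‖w‖ := norm_pos_iff.2 hw
  have him : (-w⁻¹).im = w.im / ‖w‖ ^ 2 := by
    rw [Complex.neg_im, Complex.inv_im, neg_div, neg_neg, Complex.normSq_eq_norm_sq]
  have hψj := hψ j
  refine ⟨?_, ?_⟩
  · rw [Complex.im_ofReal_mul]
    exact mul_pos hψj (neg_inv_im_pos (hη.trans_le h))
  · rw [Complex.im_ofReal_mul, him, norm_mul, Complex.norm_real, Real.norm_of_nonneg hψj.le,
      norm_neg, norm_inv]
    have : η * (ψ j * ‖w‖⁻¹) ^ 2 = ψ j * (ψ j * (η / ‖w‖ ^ 2)) := by field_simp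
    rw [this]
    gcongr

lemma InHorodisc.norm_le (h : InHorodisc ψ η n) (hη : 0 < η) (j : Fin 3) :
    ‖n j‖ ≤ ψ j / η := by
  rw [le_div_iff₀ hη]
  obtain ⟨h0, h1⟩ := h j
  have h2 : 0 < ‖n j‖ := norm_pos_iff.2 (ne_zero_of_im_pos h0)
  have h3 : (n j).im ≤ ‖n j‖ := (le_abs_self _).trans (Complex.abs_im_le_norm _)
  have hψ : 0 < ψ j := by
    by_contra hψ
    push Not at hψ
    nlinarith [mul_nonneg_of_nonpos_of_nonpos hψ (neg_nonpos.2 h0.le), mul_pos hη (pow_pos h2 2)]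
  have : η * ‖n j‖ ^ 2 ≤ ψ j * ‖n j‖ := h1.trans (mul_le_mul_of_nonneg_left h3 hψ.le)
  nlinarith

/-- A bound for the self-energies on horodiscs. -/
noncomputable def energyBound (a b c e : ℝ) (ψ : Fin 3 → ℝ) (η : ℝ) : ℝ :=
  (a + b + c + e) * (ψ 2 / η) + (c * (ψ 0 / η) + e * (ψ 1 / η)) +
    ((a * (ψ 0 / η) + b * (ψ 1 / η)) + (a * (ψ 0 / η) + b * (ψ 1 / η)) ^ 2 * (ψ 2 / η))

lemma selfEnergy_norm_le (ha : 0 ≤ a) (hb : 0 ≤ b) (hc : 0 ≤ c) (he : 0 ≤ e) (hψ : ∀ j, 0 < ψ j)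
    (hη : 0 < η) (h : InHorodisc ψ η n) (j : Fin 3) :
    ‖selfEnergy a b c e n j‖ ≤ energyBound a b c e ψ η := by
  have hn := fun j => (h j).1
  have h0 := h.norm_le hη 0
  have h1 := h.norm_le hη 1
  have h2 := h.norm_le hη 2
  have p0 := div_pos (hψ 0) hη
  have p1 := div_pos (hψ 1) hη
  have p2 := div_pos (hψ 2) hη
  have hS := weight_im_nonneg ha hb hn
  have hD := one_sub_mul_ne_zero hS (hn 2)
  have nS : ‖(a * n 0 + b * n 1 : ℂ)‖ ≤ a * (ψ 0 / η) + b * (ψ 1 / η) := by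
    refine (norm_add_le _ _).trans ?_
    rw [norm_mul, norm_mul, Complex.norm_real, Complex.norm_real, Real.norm_of_nonneg ha,
      Real.norm_of_nonneg hb]
    gcongr
  have nR : ‖n 2 / (1 - (a * n 0 + b * n 1) * n 2)‖ ≤ ψ 2 / η := by
    rw [div_one_sub_mul hS (hn 2), norm_neg, norm_inv, ← inv_div]
    have : η / ψ 2 ≤ (a * n 0 + b * n 1 + -(n 2)⁻¹ : ℂ).im := by
      rw [Complex.add_im]
      have : η / ψ 2 ≤ (-(n 2)⁻¹).im := by
        rw [Complex.neg_im, Complex.inv_im, neg_div, neg_neg, Complex.normSq_eq_norm_sq,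
          div_le_div_iff₀ (hψ 2) (pow_pos (norm_pos_iff.2 (ne_zero_of_im_pos (hn 2))) 2)]
        linarith [(h 2).2]
      linarith
    apply inv_anti₀ (div_pos hη (hψ 2))
    exact this.trans ((le_abs_self _).trans (Complex.abs_im_le_norm _))
  have nT : ‖(a * n 0 + b * n 1) / (1 - (a * n 0 + b * n 1) * n 2)‖ ≤
      (a * (ψ 0 / η) + b * (ψ 1 / η)) + (a * (ψ 0 / η) + b * (ψ 1 / η)) ^ 2 * (ψ 2 / η) := by
    -- One step of the resolvent expansion reduces to the bound `nR` and avoids inverting the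
    -- weight, which may be zero.
    have : (a * n 0 + b * n 1) / (1 - (a * n 0 + b * n 1) * n 2) = (a * n 0 + b * n 1) +
        (a * n 0 + b * n 1) ^ 2 * (n 2 / (1 - (a * n 0 + b * n 1) * n 2)) := by
      field_simp; ring
    rw [this]
    refine (norm_add_le _ _).trans ?_
    rw [norm_mul, norm_pow]
    gcongr
  have nrm : ∀ {t K : ℝ} {z : ℂ}, 0 ≤ t → ‖z‖ ≤ K → ‖t * z‖ ≤ t * K := by
    intro t K z ht hz
    rw [norm_mul, Complex.norm_real, Real.norm_of_nonneg ht]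
    gcongr
  have q1 : 0 ≤ c * (ψ 0 / η) + e * (ψ 1 / η) := by positivity
  have q2 : 0 ≤ (a * (ψ 0 / η) + b * (ψ 1 / η)) +
    (a * (ψ 0 / η) + b * (ψ 1 / η)) ^ 2 * (ψ 2 / η) := by positivity
  have qa : 0 ≤ a * (ψ 2 / η) := by positivity
  have qb : 0 ≤ b * (ψ 2 / η) := by positivity
  have qc : 0 ≤ c * (ψ 2 / η) := by positivity
  have qe : 0 ≤ e * (ψ 2 / η) := by positivity
  unfold energyBound
  fin_cases j
  · have := norm_add_le_of_le (nrm hc h2) (nrm ha nR)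
    simp only [selfEnergy, Fin.zero_eta, Matrix.cons_val_zero]
    linarith
  · have := norm_add_le_of_le (nrm he h2) (nrm hb nR)
    simp only [selfEnergy, Fin.mk_one, Matrix.cons_val_one, Matrix.cons_val_zero]
    linarith
  · have := norm_add_le_of_le (norm_add_le_of_le (nrm hc h0) (nrm he h1)) nT
    simp only [selfEnergy, Fin.reduceFinMk, Matrix.cons_val]
    linarith

lemma energyBound_nonneg (ha : 0 ≤ a) (hb : 0 ≤ b) (hc : 0 ≤ c) (he : 0 ≤ e) (hψ : ∀ j, 0 < ψ j)
    (hη : 0 < η) : 0 ≤ energyBound a b c e ψ η := by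
  have p0 := div_pos (hψ 0) hη
  have p1 := div_pos (hψ 1) hη
  have p2 := div_pos (hψ 2) hη
  unfold energyBound
  positivity

/-- The contraction factor of `nuStep` on horodiscs. -/
noncomputable def contraction (a b c e : ℝ) (ψ : Fin 3 → ℝ) (η : ℝ) : ℝ :=
  energyBound a b c e ψ η / (energyBound a b c e ψ η + η)

lemma contraction_nonneg (ha : 0 ≤ a) (hb : 0 ≤ b) (hc : 0 ≤ c) (he : 0 ≤ e) (hψ : ∀ j, 0 < ψ j)
    (hη : 0 < η) : 0 ≤ contraction a b c e ψ η := by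
  have := energyBound_nonneg ha hb hc he hψ hη
  unfold contraction
  positivity

lemma contraction_lt_one (ha : 0 ≤ a) (hb : 0 ≤ b) (hc : 0 ≤ c) (he : 0 ≤ e) (hψ : ∀ j, 0 < ψ j)
    (hη : 0 < η) : contraction a b c e ψ η < 1 := by
  have := energyBound_nonneg ha hb hc he hψ hη
  unfold contraction
  rw [div_lt_one (by linarith)]
  linarith

/-- The self-energies keep the constant `r`. Adding `ξ` gains the factor `K / (K + η)`, with `K` the
bound on their height, and the inversion and the scaling by `ψⱼ` keep it. -/
lemma nuStep_hypClose {r : ℝ} (hr : 0 ≤ r) (ha : 0 ≤ a) (hb : 0 ≤ b) (hc : 0 ≤ c) (he : 0 ≤ e)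
    (hψ : ∀ j, 0 < ψ j) (hη : 0 < η) (hξ : η ≤ ξ.im)
    (hn : InHorodisc ψ η n) (hm : InHorodisc ψ η m) (h : ∀ j, HypClose r (n j) (m j))
    (j : Fin 3) : HypClose (contraction a b c e ψ η * r) (nuStep a b c e ψ ξ n j)
      (nuStep a b c e ψ ξ m j) := by
  have hn' := fun j => (hn j).1
  have hm' := fun j => (hm j).1
  have le : ∀ {z : ℂ} {K : ℝ}, ‖z‖ ≤ K → z.im ≤ K := fun h =>
    (le_abs_self _).trans ((Complex.abs_im_le_norm _).trans h)
  have := (selfEnergy_hypClose hr ha hb hc he hn' hm' h j).contract hr hη hξ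
    (selfEnergy_im_nonneg ha hb hc he hn' j) (selfEnergy_im_nonneg ha hb hc he hm' j)
    (le (selfEnergy_norm_le ha hb hc he hψ hη hn j)) (le (selfEnergy_norm_le ha hb hc he hψ hη hm j))
  refine (this.neg_inv ?_ ?_).smul (hψ j).le
  · exact ne_zero_of_im_pos (hη.trans_le (add_selfEnergy_im ha hb hc he hξ hn' j))
  · exact ne_zero_of_im_pos (hη.trans_le (add_selfEnergy_im ha hb hc he hξ hm' j))

end Step

/-! ### Existence, uniqueness and analyticity of the fixed point -/

section FixedPoint

variable {a b c e : ℝ} {ψ : Fin 3 → ℝ} {n m : Fin 3 → ℂ} {ξ : ℂ} {η R : ℝ}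

lemma InHorodisc.im_le (h : InHorodisc ψ η n) (hη : 0 < η) (j : Fin 3) : (n j).im ≤ ψ j / η :=
  (le_abs_self _).trans ((Complex.abs_im_le_norm _).trans (h.norm_le hη j))

/-- Fixed points lie in the horodisc, being images of the map. Applying the map leaves them in place
but multiplies the constant in `HypClose` by `q < 1`, so the constant can be taken arbitrarily
small. -/
theorem nuStep_fixed_unique (ha : 0 ≤ a) (hb : 0 ≤ b) (hc : 0 ≤ c) (he : 0 ≤ e)
    (hψ : ∀ j, 0 < ψ j) (hξ : 0 < ξ.im) (hn : ∀ j, 0 < (n j).im) (hm : ∀ j, 0 < (m j).im)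
    (hfn : nuStep a b c e ψ ξ n = n) (hfm : nuStep a b c e ψ ξ m = m) : n = m := by
  have Hn : InHorodisc ψ ξ.im n := hfn ▸ nuStep_inHorodisc ha hb hc he hψ hξ le_rfl hn
  have Hm : InHorodisc ψ ξ.im m := hfm ▸ nuStep_inHorodisc ha hb hc he hψ hξ le_rfl hm
  set q := contraction a b c e ψ ξ.im
  have hq0 : 0 ≤ q := contraction_nonneg ha hb hc he hψ hξ
  have hq1 : q < 1 := contraction_lt_one ha hb hc he hψ hξ
  set s : Fin 3 → ℝ := fun j => Real.sqrt (n j).im * Real.sqrt (m j).im with hs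
  have hspos : ∀ j, 0 < s j := fun j =>
    mul_pos (Real.sqrt_pos.2 (hn j)) (Real.sqrt_pos.2 (hm j))
  set r : ℝ := ∑ j, ‖n j - m j‖ / s j with hr
  have hr0 : 0 ≤ r := Finset.sum_nonneg fun j _ => div_nonneg (norm_nonneg _) (hspos j).le
  have hk : ∀ k : ℕ, ∀ j, HypClose (q ^ k * r) (n j) (m j) := by
    intro k
    induction k with
    | zero =>
      intro j
      rw [pow_zero, one_mul]
      change ‖n j - m j‖ ≤ r * s j
      rw [← div_le_iff₀ (hspos j)]
      exact Finset.single_le_sum (f := fun j => ‖n j - m j‖ / s j)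
        (fun j _ => div_nonneg (norm_nonneg _) (hspos j).le) (Finset.mem_univ j)
    | succ k ih =>
      intro j
      have := nuStep_hypClose (mul_nonneg (pow_nonneg hq0 k) hr0) ha hb hc he hψ hξ le_rfl Hn Hm ih j
      rw [hfn, hfm] at this
      rw [pow_succ', mul_assoc]
      exact this
  funext j
  have hlim : Tendsto (fun k : ℕ => q ^ k * r * s j) atTop (𝓝 (0 * r * s j)) :=
    ((tendsto_pow_atTop_nhds_zero_of_lt_one hq0 hq1).mul_const _).mul_const _
  have : ‖n j - m j‖ ≤ 0 * r * s j := ge_of_tendsto' hlim fun k => hk k j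
  rw [zero_mul, zero_mul] at this
  exact sub_eq_zero.1 (norm_le_zero_iff.1 this)

/-- The iterates of `nuStep`. -/
noncomputable def nuIter (a b c e : ℝ) (ψ : Fin 3 → ℝ) (k : ℕ) (ξ : ℂ) : Fin 3 → ℂ :=
  (nuStep a b c e ψ ξ)^[k] fun _ => Complex.I

lemma nuIter_succ (k : ℕ) :
    nuIter a b c e ψ (k + 1) ξ = nuStep a b c e ψ ξ (nuIter a b c e ψ k ξ) :=
  Function.iterate_succ_apply' _ _ _

lemma nuIter_im_pos (ha : 0 ≤ a) (hb : 0 ≤ b) (hc : 0 ≤ c) (he : 0 ≤ e) (hψ : ∀ j, 0 < ψ j)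
    (hξ : 0 < ξ.im) (k : ℕ) (j : Fin 3) : 0 < (nuIter a b c e ψ k ξ j).im := by
  induction k generalizing j with
  | zero => simp [nuIter]
  | succ k ih => rw [nuIter_succ]; exact (nuStep_inHorodisc ha hb hc he hψ hξ le_rfl ih j).1

lemma nuIter_inHorodisc (ha : 0 ≤ a) (hb : 0 ≤ b) (hc : 0 ≤ c) (he : 0 ≤ e) (hψ : ∀ j, 0 < ψ j)
    (hη : 0 < η) (hξ : η ≤ ξ.im) (k : ℕ) : InHorodisc ψ η (nuIter a b c e ψ (k + 1) ξ) := by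
  rw [nuIter_succ]
  exact nuStep_inHorodisc ha hb hc he hψ hη hξ
    (nuIter_im_pos ha hb hc he hψ (hη.trans_le hξ) k)

/-- Keeps iterates away from the real axis, locally uniformly in `ξ`. This starts the contraction
with a finite hyperbolic constant and puts the limit in the open half plane. -/
lemma le_nuStep_im (ha : 0 ≤ a) (hb : 0 ≤ b) (hc : 0 ≤ c) (he : 0 ≤ e) (hψ : ∀ j, 0 < ψ j)
    (hη : 0 < η) (hξ : η ≤ ξ.im) (hR : ‖ξ‖ ≤ R) (hn : InHorodisc ψ η n) (j : Fin 3) :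
    ψ j * (η / (R + energyBound a b c e ψ η) ^ 2) ≤ (nuStep a b c e ψ ξ n j).im := by
  have h := add_selfEnergy_im ha hb hc he hξ (fun j => (hn j).1) j
  have hK := norm_add_le_of_le hR (selfEnergy_norm_le ha hb hc he hψ hη hn j)
  unfold nuStep
  set w := ξ + selfEnergy a b c e n j
  have hw : 0 < ‖w‖ := norm_pos_iff.2 (ne_zero_of_im_pos (hη.trans_le h))
  rw [Complex.im_ofReal_mul, Complex.neg_im, Complex.inv_im, neg_div, neg_neg,
    Complex.normSq_eq_norm_sq]
  have := (hψ j).le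
  have := hη.le.trans h
  gcongr

/-- The shift by 2: one step enters the horodisc, and a second one gives the lower bound on
imaginary parts. -/
lemma dist_nuIter_le (ha : 0 ≤ a) (hb : 0 ≤ b) (hc : 0 ≤ c) (he : 0 ≤ e) (hψ : ∀ j, 0 < ψ j)
    (hη : 0 < η) (hξ : η ≤ ξ.im) (hR : ‖ξ‖ ≤ R) (k : ℕ) (j : Fin 3) :
    dist (nuIter a b c e ψ (k + 2) ξ j) (nuIter a b c e ψ (k + 1 + 2) ξ j) ≤
      2 * (R + energyBound a b c e ψ η) ^ 2 / η ^ 2 * (ψ j / η) *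
        contraction a b c e ψ η ^ k := by
  set q := contraction a b c e ψ η
  set K := energyBound a b c e ψ η
  have hK : 0 ≤ K := energyBound_nonneg ha hb hc he hψ hη
  have hq0 : 0 ≤ q := contraction_nonneg ha hb hc he hψ hη
  have hRpos : 0 < R := hη.trans_le (hξ.trans
    ((le_abs_self _).trans ((Complex.abs_im_le_norm _).trans hR)))
  -- Chosen so that `r` times the lower bound `ψⱼ η / (R + K)²` on the imaginary parts equals `2 ψⱼ
  -- / η`, the trivial bound on the distance.
  set r : ℝ := 2 * (R + K) ^ 2 / η ^ 2 with hr
  have hr0 : 0 ≤ r := by positivity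
  have hd := fun k => nuIter_inHorodisc ha hb hc he hψ hη hξ (k := k)
  have hk : ∀ k : ℕ, ∀ j, HypClose (q ^ k * r) (nuIter a b c e ψ (k + 2) ξ j)
      (nuIter a b c e ψ (k + 1 + 2) ξ j) := by
    intro k
    induction k with
    | zero =>
      intro j
      rw [pow_zero, one_mul]
      have l1 : ψ j * (η / (R + K) ^ 2) ≤ (nuIter a b c e ψ (0 + 2) ξ j).im := by
        rw [nuIter_succ]
        exact le_nuStep_im ha hb hc he hψ hη hξ hR (hd 0) j
      have l2 : ψ j * (η / (R + K) ^ 2) ≤ (nuIter a b c e ψ (0 + 1 + 2) ξ j).im := by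
        rw [nuIter_succ]
        exact le_nuStep_im ha hb hc he hψ hη hξ hR (hd 1) j
      have u1 := (hd 1).norm_le hη j
      have u2 := (hd 2).norm_le hη j
      have hψj := hψ j
      unfold HypClose
      calc _ ≤ ψ j / η + ψ j / η := (norm_sub_le _ _).trans (add_le_add u1 u2)
        _ = r * (ψ j * (η / (R + K) ^ 2)) := by rw [hr]; field_simp; ring
        _ = r * (Real.sqrt (ψ j * (η / (R + K) ^ 2)) * Real.sqrt (ψ j * (η / (R + K) ^ 2))) := by
            rw [Real.mul_self_sqrt (by positivity)]
        _ ≤ _ := by gcongr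
    | succ k ih =>
      intro j
      have := nuStep_hypClose (mul_nonneg (pow_nonneg hq0 k) hr0) ha hb hc he hψ hη hξ
        (hd (k + 1)) (hd (k + 2)) ih j
      rw [← nuIter_succ, ← nuIter_succ] at this
      rw [pow_succ', mul_assoc]
      exact this
  rw [dist_eq_norm]
  have i1 := (hd (k + 1)).im_le hη j
  have i2 := (hd (k + 2)).im_le hη j
  have hψj := hψ j
  calc _ ≤ q ^ k * r * (Real.sqrt (ψ j / η) * Real.sqrt (ψ j / η)) := by
        refine (hk k j).trans ?_
        gcongr
    _ = _ := by rw [Real.mul_self_sqrt (by positivity)]; ring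

/-- The limit of the iterates of `nuStep`. -/
noncomputable def nuLim (a b c e : ℝ) (ψ : Fin 3 → ℝ) (ξ : ℂ) (j : Fin 3) : ℂ :=
  limUnder atTop fun k => nuIter a b c e ψ (k + 2) ξ j

lemma tendsto_nuIter (ha : 0 ≤ a) (hb : 0 ≤ b) (hc : 0 ≤ c) (he : 0 ≤ e) (hψ : ∀ j, 0 < ψ j)
    (hξ : 0 < ξ.im) (j : Fin 3) :
    Tendsto (fun k => nuIter a b c e ψ (k + 2) ξ j) atTop (𝓝 (nuLim a b c e ψ ξ j)) :=
  CauchySeq.tendsto_limUnder (cauchySeq_of_le_geometric _ _ (contraction_lt_one ha hb hc he hψ hξ)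
    fun k => dist_nuIter_le ha hb hc he hψ hξ le_rfl le_rfl k j)

lemma nuLim_im_pos (ha : 0 ≤ a) (hb : 0 ≤ b) (hc : 0 ≤ c) (he : 0 ≤ e) (hψ : ∀ j, 0 < ψ j)
    (hξ : 0 < ξ.im) (j : Fin 3) : 0 < (nuLim a b c e ψ ξ j).im := by
  have hlim := (Complex.continuous_im.tendsto _).comp (tendsto_nuIter ha hb hc he hψ hξ j)
  have hpos : 0 < ψ j * (ξ.im / (‖ξ‖ + energyBound a b c e ψ ξ.im) ^ 2) := by
    have := hψ j
    have : 0 < ‖ξ‖ := norm_pos_iff.2 (ne_zero_of_im_pos hξ)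
    have := energyBound_nonneg ha hb hc he hψ hξ
    positivity
  refine hpos.trans_le (ge_of_tendsto' hlim fun k => ?_)
  simp only [Function.comp_apply]
  rw [nuIter_succ]
  exact le_nuStep_im ha hb hc he hψ hξ le_rfl le_rfl (nuIter_inHorodisc ha hb hc he hψ hξ le_rfl k) j

lemma tendsto_selfEnergy {ι : Type*} {l : Filter ι} {f : ι → Fin 3 → ℂ} (ha : 0 ≤ a) (hb : 0 ≤ b)
    (hn : ∀ j, 0 < (n j).im) (hf : ∀ j, Tendsto (fun i => f i j) l (𝓝 (n j))) (j : Fin 3) :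
    Tendsto (fun i => selfEnergy a b c e (f i) j) l (𝓝 (selfEnergy a b c e n j)) := by
  have hD := one_sub_mul_ne_zero (weight_im_nonneg ha hb hn) (hn 2)
  have hS : Tendsto (fun i => (a * f i 0 + b * f i 1 : ℂ)) l (𝓝 (a * n 0 + b * n 1)) :=
    ((hf 0).const_mul _).add ((hf 1).const_mul _)
  have hden := (hS.mul (hf 2)).const_sub 1
  fin_cases j
  · exact ((hf 2).const_mul _).add (((hf 2).div hden hD).const_mul _)
  · exact ((hf 2).const_mul _).add (((hf 2).div hden hD).const_mul _)
  · exact (((hf 0).const_mul _).add ((hf 1).const_mul _)).add (hS.div hden hD)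

lemma nuStep_nuLim (ha : 0 ≤ a) (hb : 0 ≤ b) (hc : 0 ≤ c) (he : 0 ≤ e) (hψ : ∀ j, 0 < ψ j)
    (hξ : 0 < ξ.im) : nuStep a b c e ψ ξ (nuLim a b c e ψ ξ) = nuLim a b c e ψ ξ := by
  have hpos := nuLim_im_pos ha hb hc he hψ hξ
  have hlim := tendsto_nuIter ha hb hc he hψ hξ
  funext j
  have h1 : Tendsto (fun k => nuStep a b c e ψ ξ (nuIter a b c e ψ (k + 2) ξ) j) atTop
      (𝓝 (nuStep a b c e ψ ξ (nuLim a b c e ψ ξ) j)) := by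
    refine (Tendsto.neg (Tendsto.inv₀ ?_ ?_)).const_mul _
    · exact (tendsto_selfEnergy ha hb hpos hlim j).const_add _
    · exact ne_zero_of_im_pos (hξ.trans_le (add_selfEnergy_im ha hb hc he le_rfl hpos j))
  have h2 := (hlim j).comp (tendsto_add_atTop_nat 1)
  refine tendsto_nhds_unique h1 (h2.congr fun k => ?_)
  simp only [Function.comp_apply]
  rw [show k + 1 + 2 = (k + 2) + 1 by ring, nuIter_succ]

lemma isOpen_upperHalf : IsOpen upperHalf := isOpen_lt continuous_const Complex.continuous_im

lemma differentiableOn_nuIter (ha : 0 ≤ a) (hb : 0 ≤ b) (hc : 0 ≤ c) (he : 0 ≤ e)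
    (hψ : ∀ j, 0 < ψ j) (k : ℕ) (j : Fin 3) :
    DifferentiableOn ℂ (fun ξ => nuIter a b c e ψ k ξ j) upperHalf := by
  induction k generalizing j with
  | zero => simp [nuIter]
  | succ k ih =>
    simp only [nuIter_succ]
    have hpos := fun ξ (hξ : ξ ∈ upperHalf) => nuIter_im_pos ha hb hc he hψ hξ k
    have hS : DifferentiableOn ℂ (fun ξ => (a * nuIter a b c e ψ k ξ 0 +
        b * nuIter a b c e ψ k ξ 1 : ℂ)) upperHalf :=
      ((ih 0).const_mul _).add ((ih 1).const_mul _)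
    have hden := (hS.mul (ih 2)).const_sub 1
    have hD : ∀ ξ ∈ upperHalf, 1 - (a * nuIter a b c e ψ k ξ 0 + b * nuIter a b c e ψ k ξ 1) *
        nuIter a b c e ψ k ξ 2 ≠ 0 := fun ξ hξ =>
      one_sub_mul_ne_zero (weight_im_nonneg ha hb (hpos ξ hξ)) (hpos ξ hξ 2)
    have hG : DifferentiableOn ℂ (fun ξ => selfEnergy a b c e (nuIter a b c e ψ k ξ) j)
        upperHalf := by
      fin_cases j
      · exact ((ih 2).const_mul _).add (((ih 2).div hden hD).const_mul _)
      · exact ((ih 2).const_mul _).add (((ih 2).div hden hD).const_mul _)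
      · exact (((ih 0).const_mul _).add ((ih 1).const_mul _)).add (hS.div hden hD)
    refine DifferentiableOn.const_mul (DifferentiableOn.neg
      (DifferentiableOn.inv (differentiableOn_id.add hG) fun ξ hξ => ?_)) _
    exact ne_zero_of_im_pos (lt_of_lt_of_le hξ
      (add_selfEnergy_im ha hb hc he le_rfl (hpos ξ hξ) j))

/-- The geometric bound is uniform on `{Im z > η, ‖z‖ < R}`, so the limit of analytic iterates is
locally uniform. -/
lemma differentiableOn_nuLim (ha : 0 ≤ a) (hb : 0 ≤ b) (hc : 0 ≤ c) (he : 0 ≤ e)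
    (hψ : ∀ j, 0 < ψ j) (j : Fin 3) :
    DifferentiableOn ℂ (fun ξ => nuLim a b c e ψ ξ j) upperHalf := by
  refine TendstoLocallyUniformlyOn.differentiableOn (φ := atTop)
    (F := fun k ξ => nuIter a b c e ψ (k + 2) ξ j) ?_
    (Eventually.of_forall fun k => differentiableOn_nuIter ha hb hc he hψ _ j) isOpen_upperHalf
  rw [Metric.tendstoLocallyUniformlyOn_iff]
  intro ε hε ξ hξ
  have hξ' : 0 < ξ.im := hξ
  set η := ξ.im / 2
  set R := ‖ξ‖ + 1
  have hη : 0 < η := half_pos hξ'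
  set q := contraction a b c e ψ η
  have hq0 : 0 ≤ q := contraction_nonneg ha hb hc he hψ hη
  have hq1 : q < 1 := contraction_lt_one ha hb hc he hψ hη
  set C := 2 * (R + energyBound a b c e ψ η) ^ 2 / η ^ 2 * (ψ j / η)
  have hlim : Tendsto (fun k : ℕ => C * q ^ k / (1 - q)) atTop (𝓝 (C * 0 / (1 - q))) :=
    ((tendsto_pow_atTop_nhds_zero_of_lt_one hq0 hq1).const_mul C).div_const _
  rw [mul_zero, zero_div] at hlim
  refine ⟨{z | η < z.im} ∩ {z | ‖z‖ < R}, mem_nhdsWithin_of_mem_nhds (Filter.inter_mem ?_ ?_), ?_⟩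
  · exact (isOpen_lt continuous_const Complex.continuous_im).mem_nhds (half_lt_self hξ')
  · exact (isOpen_lt continuous_norm continuous_const).mem_nhds (show ‖ξ‖ < R from lt_add_one _)
  · filter_upwards [hlim.eventually (gt_mem_nhds hε)] with k hk z hz
    rw [dist_comm]
    refine lt_of_le_of_lt ?_ hk
    have hz1 : η ≤ z.im := (show η < z.im from hz.1).le
    have hz2 : ‖z‖ ≤ R := (show ‖z‖ < R from hz.2).le
    exact dist_le_of_le_geometric_of_tendsto q C hq1
      (fun k => dist_nuIter_le ha hb hc he hψ hη hz1 hz2 k j)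
      (tendsto_nuIter ha hb hc he hψ (hη.trans_le hz1) j) k

end FixedPoint

/-! ### Solving the `ν`-system -/

section NuSystem

variable {P : DRFMParams} {ξ : ℂ} {n : Fin 3 → ℂ}

lemma nuSystem_iff (hξ : 0 < ξ.im)
    (hn : ∀ j, 0 < (n j).im) : P.NuSystem ξ (n 0) (n 1) (n 2) ↔
      nuStep (P.μ₁₁ ^ 2) (P.μ₂₁ ^ 2) (P.μ₁₂ ^ 2) (P.μ₂₂ ^ 2) ![P.ψ₁, P.ψ₂, P.ψ₃] ξ n = n := by
  have hw := fun j => ne_zero_of_im_pos (hξ.trans_le (add_selfEnergy_im (sq_nonneg P.μ₁₁)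
    (sq_nonneg P.μ₂₁) (sq_nonneg P.μ₁₂) (sq_nonneg P.μ₂₂) le_rfl hn j))
  have key : ∀ (ψ x w y : ℂ), w ≠ 0 → w = -y → (x * y = ψ ↔ ψ * -w⁻¹ = x) := by
    intro ψ x w y hw hy
    obtain rfl : y = -w := by rw [hy, neg_neg]
    constructor
    · rintro rfl
      field_simp
    · intro h
      rw [← h]
      field_simp
  have w0 := hw 0
  have w1 := hw 1
  have w2 := hw 2
  rw [funext_iff, Fin.forall_fin_succ, Fin.forall_fin_succ, Fin.forall_fin_succ]
  simp only [NuSystem, nuStep]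
  refine and_congr (key _ _ _ _ w0 ?_) (and_congr (key _ _ _ _ w1 ?_) ((key _ _ _ _ w2 ?_).trans ?_))
  · simp only [selfEnergy]; push_cast; ring_nf
  · simp only [selfEnergy]; push_cast; ring_nf
  · simp only [selfEnergy, Matrix.cons_val]; push_cast; ring_nf
  · simp

theorem nuSystem_unique (h1 : 0 < P.ψ₁) (h2 : 0 < P.ψ₂) (h3 : 0 < P.ψ₃) (hξ : 0 < ξ.im)
    {m : Fin 3 → ℂ} (hn : ∀ j, 0 < (n j).im) (hm : ∀ j, 0 < (m j).im)
    (hsn : P.NuSystem ξ (n 0) (n 1) (n 2)) (hsm : P.NuSystem ξ (m 0) (m 1) (m 2)) : n = m := by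
  rw [nuSystem_iff hξ hn] at hsn
  rw [nuSystem_iff hξ hm] at hsm
  refine nuStep_fixed_unique (sq_nonneg _) (sq_nonneg _) (sq_nonneg _) (sq_nonneg _) ?_ hξ hn hm
    hsn hsm
  intro j
  fin_cases j <;> simpa

theorem exists_isNu (h1 : 0 < P.ψ₁) (h2 : 0 < P.ψ₂) (h3 : 0 < P.ψ₃) : ∃ ν, P.IsNu ν := by
  have hψ : ∀ j, 0 < (![P.ψ₁, P.ψ₂, P.ψ₃] : Fin 3 → ℝ) j := by
    intro j
    fin_cases j <;> simpa
  have ha := sq_nonneg P.μ₁₁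
  have hb := sq_nonneg P.μ₂₁
  have hc := sq_nonneg P.μ₁₂
  have he := sq_nonneg P.μ₂₂
  refine ⟨nuLim (P.μ₁₁ ^ 2) (P.μ₂₁ ^ 2) (P.μ₁₂ ^ 2) (P.μ₂₂ ^ 2) ![P.ψ₁, P.ψ₂, P.ψ₃],
    fun j => differentiableOn_nuLim ha hb hc he hψ j,
    fun ξ hξ j => nuLim_im_pos ha hb hc he hψ hξ j,
    fun ξ hξ => (nuSystem_iff hξ (nuLim_im_pos ha hb hc he hψ hξ)).2
      -- With `ξ₀ = 1`, the horodisc bound gives `‖νⱼ‖ ≤ ψⱼ` for `Im ξ ≥ 1`, which is more than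
      -- required.
      (nuStep_nuLim ha hb hc he hψ hξ), 1, one_pos, fun ξ hξ => ?_⟩
  have hξ' : 0 < ξ.im := one_pos.trans_le hξ
  have hd : InHorodisc ![P.ψ₁, P.ψ₂, P.ψ₃] 1 (nuLim (P.μ₁₁ ^ 2) (P.μ₂₁ ^ 2) (P.μ₁₂ ^ 2)
      (P.μ₂₂ ^ 2) ![P.ψ₁, P.ψ₂, P.ψ₃] ξ) := by
    rw [← nuStep_nuLim ha hb hc he hψ hξ']
    exact nuStep_inHorodisc ha hb hc he hψ one_pos hξ (nuLim_im_pos ha hb hc he hψ hξ')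
  have b0 := hd.norm_le one_pos 0
  have b1 := hd.norm_le one_pos 1
  have b2 := hd.norm_le one_pos 2
  simp only [Matrix.cons_val] at b0 b1 b2
  refine ⟨?_, ?_, ?_⟩ <;> linarith

theorem isNu_nu (h1 : 0 < P.ψ₁) (h2 : 0 < P.ψ₂) (h3 : 0 < P.ψ₃) : P.IsNu P.nu :=
  Classical.epsilon_spec (exists_isNu h1 h2 h3)

end NuSystem

/-! ### The risk as a Green function of a weighted triangle -/

/-- The determinant of the Laplacian of the weighted triangle with killing rates `t₁, t₂, t₃`. -/
def lapDet (t₁ t₂ t₃ w₁₂ w₁₃ w₂₃ : ℝ) : ℝ :=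
  t₁ * t₂ * t₃ + t₁ * t₂ * (w₁₃ + w₂₃) + t₁ * t₃ * (w₁₂ + w₂₃) + t₂ * t₃ * (w₁₂ + w₁₃) +
    (t₁ + t₂ + t₃) * (w₁₂ * w₁₃ + w₁₂ * w₂₃ + w₁₃ * w₂₃)

/-- The Laplacian of the weighted triangle with killing rates `t₁, t₂, t₃`. -/
def lapMat (t₁ t₂ t₃ w₁₂ w₁₃ w₂₃ : ℝ) : Matrix (Fin 3) (Fin 3) ℝ :=
  !![t₁ + w₁₂ + w₁₃, -w₁₂, -w₁₃;
     -w₁₂, t₂ + w₁₂ + w₂₃, -w₂₃;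
     -w₁₃, -w₂₃, t₃ + w₁₃ + w₂₃]

/-- The adjugate of `lapMat`. -/
def lapAdj (t₁ t₂ t₃ w₁₂ w₁₃ w₂₃ : ℝ) : Matrix (Fin 3) (Fin 3) ℝ :=
  let T := w₁₂ * w₁₃ + w₁₂ * w₂₃ + w₁₃ * w₂₃
  !![t₂ * t₃ + t₂ * (w₁₃ + w₂₃) + t₃ * (w₁₂ + w₂₃) + T, w₁₂ * t₃ + T, w₁₃ * t₂ + T;
     w₁₂ * t₃ + T, t₁ * t₃ + t₁ * (w₁₃ + w₂₃) + t₃ * (w₁₂ + w₁₃) + T, w₂₃ * t₁ + T;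
     w₁₃ * t₂ + T, w₂₃ * t₁ + T, t₁ * t₂ + t₁ * (w₁₂ + w₂₃) + t₂ * (w₁₂ + w₁₃) + T]

lemma lapMat_mul_lapAdj (t₁ t₂ t₃ w₁₂ w₁₃ w₂₃ : ℝ) :
    lapMat t₁ t₂ t₃ w₁₂ w₁₃ w₂₃ * lapAdj t₁ t₂ t₃ w₁₂ w₁₃ w₂₃ =
      lapDet t₁ t₂ t₃ w₁₂ w₁₃ w₂₃ • (1 : Matrix (Fin 3) (Fin 3) ℝ) := by
  ext i j
  fin_cases i <;> fin_cases j <;>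
    simp [lapMat, lapAdj, lapDet, Matrix.mul_apply, Fin.sum_univ_three] <;> ring

/-- The edges 13 and 23 already connect the triangle, so one positive killing rate is enough: the
product `(t₁ + t₂ + t₃) w₁₃ w₂₃` occurs in the determinant. -/
lemma lapDet_pos {t₁ t₂ t₃ w₁₂ w₁₃ w₂₃ : ℝ} (h1 : 0 ≤ t₁) (h2 : 0 ≤ t₂) (h3 : 0 ≤ t₃)
    (h : 0 < t₁ + t₂ + t₃) (hw12 : 0 ≤ w₁₂) (hw13 : 0 < w₁₃) (hw23 : 0 < w₂₃) :
    0 < lapDet t₁ t₂ t₃ w₁₂ w₁₃ w₂₃ := by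
  unfold lapDet
  positivity

/-- The risk in terms of the scale invariant variables `p = ν₁ν₃`, `q = ν₂ν₃` (up to sign) and the
killing rates `tⱼ = √λ |νⱼ|`, with `a = μ₁₁²`, `b = μ₂₁²`, `c = μ₁₂²`, `e = μ₂₂²`. -/
noncomputable def reducedRisk (a b c e F τ t₁ t₂ t₃ p q : ℝ) : ℝ :=
  let D := 1 + a * p + b * q
  let A := lapAdj t₁ t₂ t₃ (a * p * (b * q) / D ^ 2) (c * p + a * p / D ^ 2) (e * q + b * q / D ^ 2)
  let d := lapDet t₁ t₂ t₃ (a * p * (b * q) / D ^ 2) (c * p + a * p / D ^ 2) (e * q + b * q / D ^ 2)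
  F ^ 2 * (1 / D ^ 2 +
      ![a * p, b * q, (a * p + b * q) ^ 2] ⬝ᵥ (A.mulVec ![a * p, b * q, 1]) / (D ^ 4 * d) +
      ![c * p, e * q, 0] ⬝ᵥ (A.mulVec ![a * p, b * q, 1]) / (D ^ 2 * d)) +
    τ ^ 2 * (![0, 0, 1] ⬝ᵥ (A.mulVec ![a * p, b * q, (a * p + b * q) ^ 2]) / (D ^ 2 * d) +
      ![c * p, e * q, 0] ⬝ᵥ (A.mulVec ![0, 0, 1]) / d)

/-- The equations for the scale invariant variables. -/
structure Reduced (a b c e ψ₁ ψ₂ ψ₃ lam t₁ t₂ t₃ p q : ℝ) : Prop where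
  t₁_pos : 0 < t₁
  t₂_pos : 0 < t₂
  t₃_pos : 0 < t₃
  p_pos : 0 < p
  q_pos : 0 < q
  eq₁ : t₁ + c * p + a * p / (1 + a * p + b * q) = ψ₁
  eq₂ : t₂ + e * q + b * q / (1 + a * p + b * q) = ψ₂
  eq₃ : t₃ + c * p + e * q + (a * p + b * q) / (1 + a * p + b * q) = ψ₃
  mul₁₃ : t₁ * t₃ = lam * p
  mul₂₃ : t₂ * t₃ = lam * q

variable {P : DRFMParams}

/-- The reflection `z ↦ -conj z` fixes `√λ i` and maps solutions of the system in the upper half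
plane to solutions. By uniqueness the solution is invariant, hence purely imaginary. -/
theorem exists_nuStar_eq (h1 : 0 < P.ψ₁) (h2 : 0 < P.ψ₂) (h3 : 0 < P.ψ₃) {lam : ℝ}
    (hlam : 0 < lam) : ∃ x : Fin 3 → ℝ, (∀ j, 0 < x j) ∧
      (∀ j, P.nuStar lam j = x j * Complex.I) ∧
      P.NuSystem (Real.sqrt lam * Complex.I) (x 0 * Complex.I) (x 1 * Complex.I)
        (x 2 * Complex.I) := by
  have hnu := isNu_nu h1 h2 h3
  set ξ : ℂ := Real.sqrt lam * Complex.I with hξdef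
  have hξ : 0 < ξ.im := by
    rw [hξdef, Complex.im_ofReal_mul, Complex.I_im, mul_one]
    exact Real.sqrt_pos.2 hlam
  have hs := hnu.system ξ hξ
  have hpos := hnu.mapsTo ξ hξ
  set n := P.nu ξ with hn
  have hpos' : ∀ j, 0 < ((fun j => -(starRingEnd ℂ) (n j)) j).im := by
    intro j
    rw [Complex.neg_im, Complex.conj_im, neg_neg]
    exact hpos j
  have hconj : (starRingEnd ℂ) ξ = -ξ := by
    rw [hξdef, map_mul, Complex.conj_ofReal, Complex.conj_I]; ring
  have hs' : P.NuSystem ξ ((fun j => -(starRingEnd ℂ) (n j)) 0) ((fun j => -(starRingEnd ℂ) (n j)) 1)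
      ((fun j => -(starRingEnd ℂ) (n j)) 2) := by
    obtain ⟨e1, e2, e3⟩ := hs
    have e1 := congrArg (starRingEnd ℂ) e1
    have e2 := congrArg (starRingEnd ℂ) e2
    have e3 := congrArg (starRingEnd ℂ) e3
    simp only [map_mul, map_sub, map_neg, map_div₀, map_add, map_pow, map_one, Complex.conj_ofReal,
      hconj] at e1 e2 e3
    refine ⟨?_, ?_, ?_⟩
    · simp only [mul_neg, neg_mul, neg_neg]
      rw [← e1]; ring
    · simp only [mul_neg, neg_mul, neg_neg]
      rw [← e2]; ring
    · simp only [mul_neg, neg_mul, neg_neg]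
      rw [← e3]; ring
  have heq := nuSystem_unique h1 h2 h3 hξ hpos hpos' hs hs'
  have him : ∀ j, n j = ((n j).im : ℂ) * Complex.I := by
    intro j
    have hre := congrArg Complex.re (congrFun heq j)
    rw [Complex.neg_re, Complex.conj_re] at hre
    apply Complex.ext
    · rw [Complex.re_ofReal_mul, Complex.I_re, mul_zero]; linarith
    · rw [Complex.im_ofReal_mul, Complex.I_im, mul_one]
  refine ⟨fun j => (n j).im, hpos, him, ?_⟩
  rw [← him, ← him, ← him]
  exact hs

/-- The `ν`-system on the imaginary axis, in real terms. -/
lemma real_system {lam : ℝ} {x : Fin 3 → ℝ}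
    (hs : P.NuSystem (Real.sqrt lam * Complex.I) (x 0 * Complex.I) (x 1 * Complex.I)
        (x 2 * Complex.I)) :
    x 0 * (Real.sqrt lam + P.μ₁₂ ^ 2 * x 2 + P.μ₁₁ ^ 2 * x 2 /
      (1 + P.μ₁₁ ^ 2 * (x 0 * x 2) + P.μ₂₁ ^ 2 * (x 1 * x 2))) = P.ψ₁ ∧
    x 1 * (Real.sqrt lam + P.μ₂₂ ^ 2 * x 2 + P.μ₂₁ ^ 2 * x 2 /
      (1 + P.μ₁₁ ^ 2 * (x 0 * x 2) + P.μ₂₁ ^ 2 * (x 1 * x 2))) = P.ψ₂ ∧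
    x 2 * (Real.sqrt lam + P.μ₁₂ ^ 2 * x 0 + P.μ₂₂ ^ 2 * x 1 +
      (P.μ₁₁ ^ 2 * x 0 + P.μ₂₁ ^ 2 * x 1) /
      (1 + P.μ₁₁ ^ 2 * (x 0 * x 2) + P.μ₂₁ ^ 2 * (x 1 * x 2))) = P.ψ₃ := by
  have hI := Complex.I_mul_I
  have hD : (1 - (P.μ₂₁ : ℂ) ^ 2 * (x 1 * Complex.I) * (x 2 * Complex.I)
      - (P.μ₁₁ : ℂ) ^ 2 * (x 0 * Complex.I) * (x 2 * Complex.I)) =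
      ((1 + P.μ₁₁ ^ 2 * (x 0 * x 2) + P.μ₂₁ ^ 2 * (x 1 * x 2) : ℝ) : ℂ) := by
    push_cast
    linear_combination (-(P.μ₂₁ : ℂ) ^ 2 * x 1 * x 2 - (P.μ₁₁ : ℂ) ^ 2 * x 0 * x 2) * hI
  have hD' : (1 - (P.μ₁₁ : ℂ) ^ 2 * (x 0 * Complex.I) * (x 2 * Complex.I)
      - (P.μ₂₁ : ℂ) ^ 2 * (x 1 * Complex.I) * (x 2 * Complex.I)) =
      ((1 + P.μ₁₁ ^ 2 * (x 0 * x 2) + P.μ₂₁ ^ 2 * (x 1 * x 2) : ℝ) : ℂ) := by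
    rw [← hD]; ring
  obtain ⟨e1, e2, e3⟩ := hs
  rw [hD] at e1
  rw [hD'] at e2 e3
  generalize (1 + P.μ₁₁ ^ 2 * (x 0 * x 2) + P.μ₂₁ ^ 2 * (x 1 * x 2)) = D at *
  refine ⟨?_, ?_, ?_⟩
  · apply Complex.ofReal_injective
    rw [← e1]; push_cast
    linear_combination ((x 0 : ℂ) * (Real.sqrt lam + P.μ₁₂ ^ 2 * x 2 + P.μ₁₁ ^ 2 * x 2 / D)) * hI
  · apply Complex.ofReal_injective
    rw [← e2]; push_cast
    linear_combination ((x 1 : ℂ) * (Real.sqrt lam + P.μ₂₂ ^ 2 * x 2 + P.μ₂₁ ^ 2 * x 2 / D)) * hI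
  · apply Complex.ofReal_injective
    rw [← e3]; push_cast
    linear_combination ((x 2 : ℂ) * (Real.sqrt lam + P.μ₁₂ ^ 2 * x 0 + P.μ₂₂ ^ 2 * x 1 +
      (P.μ₁₁ ^ 2 * x 0 + P.μ₂₁ ^ 2 * x 1) / D)) * hI

lemma reduced_of_real {a b c e ψ₁ ψ₂ ψ₃ lam x₁ x₂ x₃ : ℝ} (hlam : 0 < lam)
    (h1 : 0 < x₁) (h2 : 0 < x₂) (h3 : 0 < x₃)
    (e1 : x₁ * (Real.sqrt lam + c * x₃ + a * x₃ / (1 + a * (x₁ * x₃) + b * (x₂ * x₃))) = ψ₁)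
    (e2 : x₂ * (Real.sqrt lam + e * x₃ + b * x₃ / (1 + a * (x₁ * x₃) + b * (x₂ * x₃))) = ψ₂)
    (e3 : x₃ * (Real.sqrt lam + c * x₁ + e * x₂ +
      (a * x₁ + b * x₂) / (1 + a * (x₁ * x₃) + b * (x₂ * x₃))) = ψ₃) :
    Reduced a b c e ψ₁ ψ₂ ψ₃ lam (Real.sqrt lam * x₁) (Real.sqrt lam * x₂) (Real.sqrt lam * x₃)
      (x₁ * x₃) (x₂ * x₃) := by
  have hs := Real.sqrt_pos.2 hlam
  have hss := Real.mul_self_sqrt hlam.le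
  refine ⟨by positivity, by positivity, by positivity, by positivity, by positivity, ?_, ?_, ?_,
    ?_, ?_⟩
  · rw [← e1]; ring
  · rw [← e2]; ring
  · rw [← e3]; ring
  · linear_combination x₁ * x₃ * hss
  · linear_combination x₂ * x₃ * hss

/-- The real form of `H`. -/
noncomputable def realH (a b c e ψ₁ ψ₂ ψ₃ x₁ x₂ x₃ D : ℝ) : Matrix (Fin 3) (Fin 3) ℝ :=
  !![x₃ ^ 2 * a ^ 2 / D ^ 2 - ψ₁ / x₁ ^ 2, x₃ ^ 2 * a * b / D ^ 2, -(a / D ^ 2) - c;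
     x₃ ^ 2 * a * b / D ^ 2, x₃ ^ 2 * b ^ 2 / D ^ 2 - ψ₂ / x₂ ^ 2, -(b / D ^ 2) - e;
     -(a / D ^ 2) - c, -(b / D ^ 2) - e, (x₁ * a + x₂ * b) ^ 2 / D ^ 2 - ψ₃ / x₃ ^ 2]

/-- The real form of `V`. -/
noncomputable def realV (a b c e x₁ x₂ x₃ D : ℝ) : Matrix (Fin 3) (Fin 4) ℝ :=
  !![c, 0, a / D ^ 2, -(x₃ ^ 2 * a / D ^ 2);
     e, 0, b / D ^ 2, -(x₃ ^ 2 * b / D ^ 2);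
     0, 1, -((x₁ * a + x₂ * b) ^ 2 / D ^ 2), 1 / D ^ 2]

/-- The equations express `ψⱼ` through the killing rate and the couplings, and `D - ap = 1 + bq`
makes the diagonal entries the row sums of a Laplacian. The minus sign at `x₃` gives all
off-diagonal entries the same sign. -/
lemma realH_eq {a b c e ψ₁ ψ₂ ψ₃ lam x₁ x₂ x₃ t₁ t₂ t₃ D : ℝ}
    (h1 : 0 < x₁) (h2 : 0 < x₂) (h3 : 0 < x₃) (hD : D ≠ 0)
    (hDe : D = 1 + a * (x₁ * x₃) + b * (x₂ * x₃))
    (h : Reduced a b c e ψ₁ ψ₂ ψ₃ lam t₁ t₂ t₃ (x₁ * x₃) (x₂ * x₃)) :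
    realH a b c e ψ₁ ψ₂ ψ₃ x₁ x₂ x₃ D = -(Matrix.diagonal ![x₁⁻¹, x₂⁻¹, -x₃⁻¹] *
      lapMat t₁ t₂ t₃ (a * (x₁ * x₃) * (b * (x₂ * x₃)) / D ^ 2)
        (c * (x₁ * x₃) + a * (x₁ * x₃) / D ^ 2) (e * (x₂ * x₃) + b * (x₂ * x₃) / D ^ 2) *
      Matrix.diagonal ![x₁⁻¹, x₂⁻¹, -x₃⁻¹]) := by
  have e1 := h.eq₁
  have e2 := h.eq₂
  have e3 := h.eq₃
  rw [← hDe] at e1 e2 e3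
  ext i j
  fin_cases i <;> fin_cases j <;>
    simp [realH, lapMat, Matrix.mul_diagonal, Matrix.diagonal_mul, -neg_add_rev]
  · rw [← e1]; field_simp; rw [hDe]; ring
  · field_simp
  · field_simp; ring
  · field_simp
  · rw [← e2]; field_simp; rw [hDe]; ring
  · field_simp; ring
  · field_simp; ring
  · field_simp; ring
  · rw [← e3]; field_simp; rw [hDe]; ring

lemma realH_inv {a b c e ψ₁ ψ₂ ψ₃ lam x₁ x₂ x₃ t₁ t₂ t₃ D w₁₂ w₁₃ w₂₃ : ℝ}
    (h1 : 0 < x₁) (h2 : 0 < x₂) (h3 : 0 < x₃) (hD : D ≠ 0)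
    (hDe : D = 1 + a * (x₁ * x₃) + b * (x₂ * x₃))
    (h : Reduced a b c e ψ₁ ψ₂ ψ₃ lam t₁ t₂ t₃ (x₁ * x₃) (x₂ * x₃))
    (hw12 : w₁₂ = a * (x₁ * x₃) * (b * (x₂ * x₃)) / D ^ 2)
    (hw13 : w₁₃ = c * (x₁ * x₃) + a * (x₁ * x₃) / D ^ 2)
    (hw23 : w₂₃ = e * (x₂ * x₃) + b * (x₂ * x₃) / D ^ 2)
    (hdet : lapDet t₁ t₂ t₃ w₁₂ w₁₃ w₂₃ ≠ 0) :
    realH a b c e ψ₁ ψ₂ ψ₃ x₁ x₂ x₃ D * ((-(lapDet t₁ t₂ t₃ w₁₂ w₁₃ w₂₃)⁻¹) •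
      (Matrix.diagonal ![x₁, x₂, -x₃] * lapAdj t₁ t₂ t₃ w₁₂ w₁₃ w₂₃ *
        Matrix.diagonal ![x₁, x₂, -x₃])) = 1 := by
  rw [realH_eq h1 h2 h3 hD hDe h, ← hw12, ← hw13, ← hw23]
  have hdd : Matrix.diagonal ![x₁⁻¹, x₂⁻¹, -x₃⁻¹] * Matrix.diagonal ![x₁, x₂, -x₃] = 1 := by
    rw [Matrix.diagonal_mul_diagonal, ← Matrix.diagonal_one]
    congr 1
    funext i
    fin_cases i <;> simp [h1.ne', h2.ne', h3.ne']
  set A := Matrix.diagonal ![x₁⁻¹, x₂⁻¹, -x₃⁻¹]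
  set B := Matrix.diagonal ![x₁, x₂, -x₃]
  have hm := lapMat_mul_lapAdj t₁ t₂ t₃ w₁₂ w₁₃ w₂₃
  set M := lapMat t₁ t₂ t₃ w₁₂ w₁₃ w₂₃
  set N := lapAdj t₁ t₂ t₃ w₁₂ w₁₃ w₂₃
  set d := lapDet t₁ t₂ t₃ w₁₂ w₁₃ w₂₃
  have : A * M * A * (B * N * B) = d • 1 := by
    calc A * M * A * (B * N * B) = A * M * (A * B) * N * B := by simp only [Matrix.mul_assoc]
      _ = A * (M * N) * B := by rw [hdd]; simp only [Matrix.mul_assoc, Matrix.one_mul]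
      _ = d • 1 := by rw [hm]; simp [hdd]
  rw [Matrix.mul_smul, neg_mul, this, smul_neg, neg_smul, neg_neg, smul_smul,
    inv_mul_cancel₀ hdet, one_smul]

theorem exists_reduced (h1 : 0 < P.ψ₁) (h2 : 0 < P.ψ₂) (h3 : 0 < P.ψ₃) (hc : 0 < P.μ₁₂)
    (he : 0 < P.μ₂₂) (F τ : ℝ) {lam : ℝ} (hlam : 0 < lam) :
    ∃ t₁ t₂ t₃ p q : ℝ, Reduced (P.μ₁₁ ^ 2) (P.μ₂₁ ^ 2) (P.μ₁₂ ^ 2) (P.μ₂₂ ^ 2)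
        P.ψ₁ P.ψ₂ P.ψ₃ lam t₁ t₂ t₃ p q ∧
      P.risk F τ lam = reducedRisk (P.μ₁₁ ^ 2) (P.μ₂₁ ^ 2) (P.μ₁₂ ^ 2) (P.μ₂₂ ^ 2) F τ
        t₁ t₂ t₃ p q := by
  obtain ⟨x, hx, hnu, hs⟩ := exists_nuStar_eq h1 h2 h3 hlam
  obtain ⟨r1, r2, r3⟩ := real_system hs
  have hred := reduced_of_real hlam (hx 0) (hx 1) (hx 2) r1 r2 r3
  refine ⟨_, _, _, _, _, hred, ?_⟩
  obtain ⟨a, hae⟩ : ∃ a, a = P.μ₁₁ ^ 2 := ⟨_, rfl⟩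
  obtain ⟨b, hbe⟩ : ∃ b, b = P.μ₂₁ ^ 2 := ⟨_, rfl⟩
  obtain ⟨c, hce⟩ : ∃ c, c = P.μ₁₂ ^ 2 := ⟨_, rfl⟩
  obtain ⟨e, hee⟩ : ∃ e, e = P.μ₂₂ ^ 2 := ⟨_, rfl⟩
  have ha : 0 ≤ a := hae ▸ sq_nonneg _
  have hb : 0 ≤ b := hbe ▸ sq_nonneg _
  have hc : 0 < c := hce ▸ pow_pos hc 2
  have he : 0 < e := hee ▸ pow_pos he 2
  have haC : (P.μ₁₁ : ℂ) ^ 2 = (a : ℂ) := by rw [hae]; push_cast; rfl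
  have hbC : (P.μ₂₁ : ℂ) ^ 2 = (b : ℂ) := by rw [hbe]; push_cast; rfl
  have hcC : (P.μ₁₂ : ℂ) ^ 2 = (c : ℂ) := by rw [hce]; push_cast; rfl
  have heC : (P.μ₂₂ : ℂ) ^ 2 = (e : ℂ) := by rw [hee]; push_cast; rfl
  rw [← hae, ← hbe, ← hce, ← hee] at hred ⊢
  obtain ⟨x₁, hx₁⟩ : ∃ y, y = x 0 := ⟨_, rfl⟩
  obtain ⟨x₂, hx₂⟩ : ∃ y, y = x 1 := ⟨_, rfl⟩
  obtain ⟨x₃, hx₃⟩ : ∃ y, y = x 2 := ⟨_, rfl⟩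
  have p1 := hx 0
  have p2 := hx 1
  have p3 := hx 2
  have n1 := hnu 0
  have n2 := hnu 1
  have n3 := hnu 2
  rw [← hx₁] at p1 n1 hred ⊢
  rw [← hx₂] at p2 n2 hred ⊢
  rw [← hx₃] at p3 n3 hred ⊢
  obtain ⟨D, hD⟩ : ∃ D, D = 1 + a * (x₁ * x₃) + b * (x₂ * x₃) := ⟨_, rfl⟩
  have hDpos : 0 < D := by rw [hD]; positivity
  have hI := Complex.I_mul_I
  have hMN : P.MN lam = ((x₁ * a + x₂ * b : ℝ) : ℂ) * Complex.I := by
    rw [MN, n1, n2, haC, hbC]; push_cast; ring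
  have hMD : P.MD lam = -(D : ℂ) := by
    rw [MD, hMN, n3, hD]; push_cast
    linear_combination ((x₃ : ℂ) * (x₁ * a + x₂ * b)) * hI
  have hMN2 : P.MN lam ^ 2 = -((x₁ * a + x₂ * b : ℝ) : ℂ) ^ 2 := by
    rw [hMN, mul_pow, Complex.I_sq]; ring
  have hMD2 : P.MD lam ^ 2 = (D : ℂ) ^ 2 := by rw [hMD, neg_sq]
  have s1 : P.nuStar lam 0 ^ 2 = -(x₁ : ℂ) ^ 2 := by rw [n1, mul_pow, Complex.I_sq]; ring
  have s2 : P.nuStar lam 1 ^ 2 = -(x₂ : ℂ) ^ 2 := by rw [n2, mul_pow, Complex.I_sq]; ring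
  have s3 : P.nuStar lam 2 ^ 2 = -(x₃ : ℂ) ^ 2 := by rw [n3, mul_pow, Complex.I_sq]; ring
  have hH : P.matH lam = (realH a b c e P.ψ₁ P.ψ₂ P.ψ₃ x₁ x₂ x₃ D).map Complex.ofRealHom := by
    ext i j
    fin_cases i <;> fin_cases j <;>
      simp [matH, realH, s1, s2, s3, hMN2, hMD2, haC, hbC, hcC, heC, neg_div, div_neg] <;> ring
  have hV : P.matV lam = (realV a b c e x₁ x₂ x₃ D).map Complex.ofRealHom := by
    ext i j
    fin_cases i <;> fin_cases j <;>
      simp [matV, realV, s3, hMN2, hMD2, haC, hbC, hcC, heC, neg_div]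
  obtain ⟨w₁₂, hw12⟩ : ∃ w, w = a * (x₁ * x₃) * (b * (x₂ * x₃)) / D ^ 2 := ⟨_, rfl⟩
  obtain ⟨w₁₃, hw13⟩ : ∃ w, w = c * (x₁ * x₃) + a * (x₁ * x₃) / D ^ 2 := ⟨_, rfl⟩
  obtain ⟨w₂₃, hw23⟩ : ∃ w, w = e * (x₂ * x₃) + b * (x₂ * x₃) / D ^ 2 := ⟨_, rfl⟩
  obtain ⟨t₁, ht₁⟩ : ∃ t, t = Real.sqrt lam * x₁ := ⟨_, rfl⟩
  obtain ⟨t₂, ht₂⟩ : ∃ t, t = Real.sqrt lam * x₂ := ⟨_, rfl⟩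
  obtain ⟨t₃, ht₃⟩ : ∃ t, t = Real.sqrt lam * x₃ := ⟨_, rfl⟩
  rw [← ht₁, ← ht₂, ← ht₃] at hred ⊢
  have hdet : 0 < lapDet t₁ t₂ t₃ w₁₂ w₁₃ w₂₃ := by
    have := hred.t₁_pos
    have := hred.t₂_pos
    have := hred.t₃_pos
    apply lapDet_pos <;> first | positivity | (subst hw12 hw13 hw23; positivity)
  have hinv := realH_inv p1 p2 p3 hDpos.ne' hD hred hw12 hw13 hw23 hdet.ne'
  set W := (-(lapDet t₁ t₂ t₃ w₁₂ w₁₃ w₂₃)⁻¹) •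
      (Matrix.diagonal ![x₁, x₂, -x₃] * lapAdj t₁ t₂ t₃ w₁₂ w₁₃ w₂₃ *
        Matrix.diagonal ![x₁, x₂, -x₃]) with hW
  have hHinv : (P.matH lam)⁻¹ = W.map Complex.ofRealHom := by
    apply Matrix.inv_eq_right_inv
    rw [hH, ← Matrix.map_mul, hinv]
    simp
  have hL : P.matL lam = ((realV a b c e x₁ x₂ x₃ D).transpose * W *
      realV a b c e x₁ x₂ x₃ D).map Complex.ofRealHom := by
    rw [matL, hHinv, hV, Matrix.map_mul, Matrix.map_mul, Matrix.transpose_map]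
  set M := (realV a b c e x₁ x₂ x₃ D).transpose * W * realV a b c e x₁ x₂ x₃ D with hM
  have hrisk : P.risk F τ lam = F ^ 2 * (1 / D ^ 2 + M 2 3 + M 0 3) + τ ^ 2 * (M 1 2 + M 0 1) := by
    rw [risk, hL, hMD2]
    simp only [Matrix.map_apply, Complex.ofRealHom_eq_coe]
    rw [← Complex.ofReal_re (F ^ 2 * (1 / D ^ 2 + M 2 3 + M 0 3) + τ ^ 2 * (M 1 2 + M 0 1))]
    congr 1
    push_cast
    ring
  rw [hrisk]
  simp only [reducedRisk]
  rw [← hD, ← hw12, ← hw13, ← hw23]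
  generalize lapDet t₁ t₂ t₃ w₁₂ w₁₃ w₂₃ = d at *
  generalize lapAdj t₁ t₂ t₃ w₁₂ w₁₃ w₂₃ = A at *
  have hMij : ∀ i j, M i j = -d⁻¹ * ∑ k, ∑ l, (![x₁, x₂, -x₃] k * realV a b c e x₁ x₂ x₃ D k i) *
      A k l * (![x₁, x₂, -x₃] l * realV a b c e x₁ x₂ x₃ D l j) := by
    intro i j
    have hWkl : ∀ k l, W k l = -d⁻¹ * (![x₁, x₂, -x₃] k * A k l * ![x₁, x₂, -x₃] l) := by
      intro k l
      rw [hW, Matrix.smul_apply, smul_eq_mul, Matrix.mul_diagonal, Matrix.diagonal_mul]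
    rw [hM, Matrix.mul_apply]
    simp only [Matrix.mul_apply, hWkl, Fin.sum_univ_three, Matrix.transpose_apply]
    ring
  simp only [hMij, realV, Fin.sum_univ_three, Matrix.mulVec, dotProduct, Matrix.of_apply,
    Matrix.cons_val]
  field_simp
  ring

/-- A map into a compact set converges if a continuous function of it does and the limit has only
one preimage. -/
lemma exists_tendsto_of_isCompact {ι X Y : Type*} [TopologicalSpace X] [TopologicalSpace Y]
    [T2Space Y] {l : Filter ι} [l.NeBot] {K : Set X} (hK : IsCompact K) {g : X → Y}
    (hg : ∀ y ∈ K, ContinuousAt g y) {u : ι → X} (hu : ∀ᶠ i in l, u i ∈ K) {z : Y}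
    (hz : Tendsto (fun i => g (u i)) l (𝓝 z))
    (huniq : ∀ y ∈ K, ∀ y' ∈ K, g y = z → g y' = z → y = y') :
    ∃ y ∈ K, g y = z ∧ Tendsto u l (𝓝 y) := by
  have hcl : ∀ y ∈ K, MapClusterPt y l u → g y = z := by
    intro y hy hmc
    have h := hmc.continuousAt_comp (hg y hy)
    have h' : ClusterPt (g y) (𝓝 z) := ClusterPt.mono h hz
    exact eq_of_nhds_neBot h'
  obtain ⟨y, hy, hmc⟩ := hK.exists_mapClusterPt_of_frequently hu.frequently
  refine ⟨y, hy, hcl y hy hmc, ?_⟩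
  exact hK.tendsto_nhds_of_unique_mapClusterPt hu fun y' hy' hmc' =>
    huniq _ hy' _ hy (hcl _ hy' hmc') (hcl _ hy hmc)

/-! ### Continuity and a lower bound for the reduced risk -/

section ReducedRisk

variable {a b c e F τ t₁ t₂ t₃ p q : ℝ}

lemma continuousAt_reducedRisk {v : ℝ × ℝ × ℝ × ℝ × ℝ} {D : ℝ}
    (hDe : D = 1 + a * v.2.2.2.1 + b * v.2.2.2.2) (hD : D ≠ 0)
    (hd : lapDet v.1 v.2.1 v.2.2.1 (a * v.2.2.2.1 * (b * v.2.2.2.2) / D ^ 2)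
      (c * v.2.2.2.1 + a * v.2.2.2.1 / D ^ 2) (e * v.2.2.2.2 + b * v.2.2.2.2 / D ^ 2) ≠ 0) :
    ContinuousAt (fun v : ℝ × ℝ × ℝ × ℝ × ℝ =>
      reducedRisk a b c e F τ v.1 v.2.1 v.2.2.1 v.2.2.2.1 v.2.2.2.2) v := by
  subst hDe
  have hD2 := pow_ne_zero 2 hD
  have hD4 := pow_ne_zero 4 hD
  unfold lapDet at hd
  simp only [reducedRisk, lapAdj, lapDet, dotProduct, Matrix.mulVec, Fin.sum_univ_three,
    Matrix.of_apply, Matrix.cons_val]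
  have := mul_ne_zero hD2 hd
  have := mul_ne_zero hD4 hd
  fun_prop (disch := assumption)

/-- All entries of the adjugate are nonnegative, so every summand of the risk is. Only the (1,3)
entry of the adjugate in `L_{1,4}` is kept, without its terms in `w₁₂`. -/
lemma le_reducedRisk {D w₁₂ w₁₃ w₂₃ : ℝ} (ha : 0 ≤ a) (hb : 0 ≤ b) (hc : 0 ≤ c) (he : 0 ≤ e)
    (ht₁ : 0 ≤ t₁) (ht₂ : 0 ≤ t₂) (ht₃ : 0 ≤ t₃) (hp : 0 ≤ p) (hq : 0 ≤ q)
    (hD : D = 1 + a * p + b * q)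
    (hw12 : w₁₂ = a * p * (b * q) / D ^ 2) (hw13 : w₁₃ = c * p + a * p / D ^ 2)
    (hw23 : w₂₃ = e * q + b * q / D ^ 2) (hd : 0 < lapDet t₁ t₂ t₃ w₁₂ w₁₃ w₂₃) :
    F ^ 2 * (c * p * (w₁₃ * t₂ + w₁₃ * w₂₃) / (D ^ 2 * lapDet t₁ t₂ t₃ w₁₂ w₁₃ w₂₃)) ≤
      reducedRisk a b c e F τ t₁ t₂ t₃ p q := by
  have hDpos : 0 < D := by rw [hD]; positivity
  have hw12' : 0 ≤ w₁₂ := by rw [hw12]; positivity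
  have hw13' : 0 ≤ w₁₃ := by rw [hw13]; positivity
  have hw23' : 0 ≤ w₂₃ := by rw [hw23]; positivity
  simp only [reducedRisk]
  rw [← hD, ← hw12, ← hw13, ← hw23]
  generalize lapDet t₁ t₂ t₃ w₁₂ w₁₃ w₂₃ = d at *
  have hA : ∀ i j, 0 ≤ lapAdj t₁ t₂ t₃ w₁₂ w₁₃ w₂₃ i j := by
    intro i j
    fin_cases i <;> fin_cases j <;> simp [lapAdj] <;> positivity
  have hA02 : w₁₃ * t₂ + w₁₃ * w₂₃ ≤ lapAdj t₁ t₂ t₃ w₁₂ w₁₃ w₂₃ 0 2 := by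
    simp only [lapAdj, Matrix.of_apply, Matrix.cons_val]
    nlinarith [mul_nonneg hw12' hw13', mul_nonneg hw12' hw23']
  generalize lapAdj t₁ t₂ t₃ w₁₂ w₁₃ w₂₃ = A at *
  have hform : ∀ u v : Fin 3 → ℝ, (∀ i, 0 ≤ u i) → (∀ i, 0 ≤ v i) → 0 ≤ u ⬝ᵥ (A.mulVec v) :=
    fun u v hu hv => Finset.sum_nonneg fun i _ => mul_nonneg (hu i)
      (show 0 ≤ ∑ j, A i j * v j from Finset.sum_nonneg fun j _ => mul_nonneg (hA i j) (hv j))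
  have vec : ∀ x y z : ℝ, 0 ≤ x → 0 ≤ y → 0 ≤ z → ∀ i, 0 ≤ (![x, y, z] : Fin 3 → ℝ) i := by
    intro x y z hx hy hz i
    fin_cases i <;> simpa
  have hap : 0 ≤ a * p := by positivity
  have hbq : 0 ≤ b * q := by positivity
  have hcp : 0 ≤ c * p := by positivity
  have heq : 0 ≤ e * q := by positivity
  have hs : 0 ≤ (a * p + b * q) ^ 2 := by positivity
  have h1 := hform _ _ (vec _ _ _ hap hbq hs) (vec _ _ _ hap hbq zero_le_one)
  have h2 := hform _ _ (vec _ _ _ le_rfl le_rfl zero_le_one) (vec _ _ _ hap hbq hs)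
  have h3 := hform _ _ (vec _ _ _ hcp heq le_rfl) (vec _ _ _ le_rfl le_rfl zero_le_one)
  have h4 : c * p * (w₁₃ * t₂ + w₁₃ * w₂₃) ≤
      ![c * p, e * q, 0] ⬝ᵥ (A.mulVec ![a * p, b * q, 1]) := by
    simp only [dotProduct, Matrix.mulVec, Fin.sum_univ_three, Matrix.cons_val]
    have := mul_le_mul_of_nonneg_left hA02 hcp
    have g1 := mul_nonneg hcp (mul_nonneg (hA 0 0) hap)
    have g2 := mul_nonneg hcp (mul_nonneg (hA 0 1) hbq)
    have g3 := mul_nonneg heq (mul_nonneg (hA 1 0) hap)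
    have g4 := mul_nonneg heq (mul_nonneg (hA 1 1) hbq)
    have g5 := mul_nonneg heq (hA 1 2)
    linarith
  have k1 : 0 ≤ 1 / D ^ 2 := by positivity
  have k2 := div_nonneg h1 (by positivity : 0 ≤ D ^ 4 * d)
  have k3 := div_nonneg h2 (by positivity : 0 ≤ D ^ 2 * d)
  have k4 := div_nonneg h3 hd.le
  have k5 := div_le_div_of_nonneg_right h4 (by positivity : 0 ≤ D ^ 2 * d)
  have k6 := mul_nonneg (sq_nonneg τ) (add_nonneg k3 k4)
  refine le_trans ?_ (le_add_of_nonneg_right k6)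
  apply mul_le_mul_of_nonneg_left _ (sq_nonneg F)
  linarith

end ReducedRisk

/-! ### Uniqueness and monotonicity for the limiting equations -/

section Balance

/-- The limiting equations for `(p, q)` with killing rates `k p` and `k q`. -/
structure Balance (a b c e ψ₁ ψ₂ k p q : ℝ) : Prop where
  k_nonneg : 0 ≤ k
  p_nonneg : 0 ≤ p
  q_nonneg : 0 ≤ q
  eq₁ : k * p + c * p + a * p / (1 + a * p + b * q) = ψ₁
  eq₂ : k * q + e * q + b * q / (1 + a * p + b * q) = ψ₂

variable {a b c e ψ₁ ψ₂ k k' p q p' q' : ℝ}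

lemma Balance.swap (h : Balance a b c e ψ₁ ψ₂ k p q) : Balance b a e c ψ₂ ψ₁ k q p :=
  ⟨h.k_nonneg, h.q_nonneg, h.p_nonneg, by rw [add_right_comm 1]; exact h.eq₂,
    by rw [add_right_comm 1]; exact h.eq₁⟩

lemma Balance.den_pos (h : Balance a b c e ψ₁ ψ₂ k p q) (ha : 0 ≤ a) (hb : 0 ≤ b) :
    0 < 1 + a * p + b * q := by
  have := h.p_nonneg
  have := h.q_nonneg
  positivity

lemma Balance.p_eq (h : Balance a b c e ψ₁ ψ₂ k p q) (ha : 0 ≤ a) (hb : 0 ≤ b) (hc : 0 < c) :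
    p = ψ₁ * (1 + a * p + b * q) / ((c + k) * (1 + a * p + b * q) + a) := by
  have hD := h.den_pos ha hb
  have e1 := h.eq₁
  have hk := h.k_nonneg
  generalize 1 + a * p + b * q = D at *
  rw [← e1]
  field_simp
  ring

lemma Balance.q_eq (h : Balance a b c e ψ₁ ψ₂ k p q) (ha : 0 ≤ a) (hb : 0 ≤ b) (he : 0 < e) :
    q = ψ₂ * (1 + a * p + b * q) / ((e + k) * (1 + a * p + b * q) + b) := by
  have := h.swap.p_eq hb ha he
  rwa [add_right_comm] at this

/-- Substituting `p` and `q` as functions of `D = 1 + ap + bq` into the definition of `D` and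
dividing by `D` leaves one scalar equation, whose left side decreases in `D` and in `kD`. -/
lemma Balance.den_eq (h : Balance a b c e ψ₁ ψ₂ k p q) (ha : 0 ≤ a) (hb : 0 ≤ b) (hc : 0 < c)
    (he : 0 < e) :
    1 / (1 + a * p + b * q) + a * ψ₁ / ((c + k) * (1 + a * p + b * q) + a) +
      b * ψ₂ / ((e + k) * (1 + a * p + b * q) + b) = 1 := by
  have hD := h.den_pos ha hb
  have hp := h.p_eq ha hb hc
  have hq := h.q_eq ha hb he
  have hk := h.k_nonneg
  have key : ∀ D : ℝ, 0 < D → D * (1 / D + a * ψ₁ / ((c + k) * D + a) +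
      b * ψ₂ / ((e + k) * D + b)) =
      1 + a * (ψ₁ * D / ((c + k) * D + a)) + b * (ψ₂ * D / ((e + k) * D + b)) := by
    intro D hD
    rw [mul_add, mul_add, mul_one_div_cancel hD.ne']
    ring
  have := key _ hD
  rw [← hp, ← hq] at this
  exact (mul_eq_left₀ hD.ne').1 this

lemma Balance.not_den_lt (h : Balance a b c e ψ₁ ψ₂ k p q) (h' : Balance a b c e ψ₁ ψ₂ k' p' q')
    (ha : 0 ≤ a) (hb : 0 ≤ b) (hc : 0 < c) (he : 0 < e) (hψ₁ : 0 ≤ ψ₁) (hψ₂ : 0 ≤ ψ₂)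
    (hk : k' * (1 + a * p' + b * q') ≤ k * (1 + a * p + b * q)) :
    ¬ 1 + a * p' + b * q' < 1 + a * p + b * q := by
  intro hlt
  have h1 := h.den_eq ha hb hc he
  have h1' := h'.den_eq ha hb hc he
  have hD := h.den_pos ha hb
  have hD' := h'.den_pos ha hb
  have hk0 := h.k_nonneg
  have hk0' := h'.k_nonneg
  generalize 1 + a * p + b * q = D at *
  generalize 1 + a * p' + b * q' = D' at *
  have i1 : 1 / D < 1 / D' := one_div_lt_one_div_of_lt hD' hlt
  have i2 : a * ψ₁ / ((c + k) * D + a) ≤ a * ψ₁ / ((c + k') * D' + a) := by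
    apply div_le_div_of_nonneg_left (by positivity) (by positivity)
    nlinarith
  have i3 : b * ψ₂ / ((e + k) * D + b) ≤ b * ψ₂ / ((e + k') * D' + b) := by
    apply div_le_div_of_nonneg_left (by positivity) (by positivity)
    nlinarith
  linarith

lemma Balance.unique (h : Balance a b c e ψ₁ ψ₂ k p q) (h' : Balance a b c e ψ₁ ψ₂ k p' q')
    (ha : 0 ≤ a) (hb : 0 ≤ b) (hc : 0 < c) (he : 0 < e) (hψ₁ : 0 ≤ ψ₁) (hψ₂ : 0 ≤ ψ₂) :
    p = p' ∧ q = q' := by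
  have hD : 1 + a * p + b * q = 1 + a * p' + b * q' := by
    rcases lt_trichotomy (1 + a * p + b * q) (1 + a * p' + b * q') with hlt | heq | hgt
    · exact (h'.not_den_lt h ha hb hc he hψ₁ hψ₂
        (mul_le_mul_of_nonneg_left hlt.le h.k_nonneg) hlt).elim
    · exact heq
    · exact (h.not_den_lt h' ha hb hc he hψ₁ hψ₂
        (mul_le_mul_of_nonneg_left hgt.le h.k_nonneg) hgt).elim
  constructor
  · rw [h.p_eq ha hb hc, h'.p_eq ha hb hc, hD]
  · rw [h.q_eq ha hb he, h'.q_eq ha hb he, hD]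

/-- Raising `k` cannot lower `kD`, by `not_den_lt`. The claim then follows from `kp = ψ₁ kD / ((c +
k) D + a)` by cross-multiplying. -/
lemma Balance.rate_lt (h : Balance a b c e ψ₁ ψ₂ k p q) (h' : Balance a b c e ψ₁ ψ₂ k' p' q')
    (ha : 0 ≤ a) (hb : 0 ≤ b) (hc : 0 < c) (he : 0 < e) (hψ₁ : 0 < ψ₁) (hψ₂ : 0 ≤ ψ₂)
    (hk : k < k') : k * p < k' * p' := by
  have hD := h.den_pos ha hb
  have hD' := h'.den_pos ha hb
  have hk0 := h.k_nonneg
  have hX : k * (1 + a * p + b * q) ≤ k' * (1 + a * p' + b * q') := by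
    by_contra hcon
    push Not at hcon
    refine h.not_den_lt h' ha hb hc he hψ₁.le hψ₂ hcon.le ?_
    by_contra hle
    push Not at hle
    nlinarith
  have e1 := h.p_eq ha hb hc
  have e1' := h'.p_eq ha hb hc
  generalize 1 + a * p + b * q = D at *
  generalize 1 + a * p' + b * q' = D' at *
  have hk0' : 0 < k' := hk0.trans_lt hk
  rw [e1, e1', ← mul_div_assoc, ← mul_div_assoc, div_lt_div_iff₀ (by positivity) (by positivity)]
  have : 0 < ψ₁ * c * D * D' * (k' - k) := by
    have := sub_pos.2 hk
    positivity
  have : 0 ≤ ψ₁ * a * (k' * D' - k * D) := mul_nonneg (by positivity) (sub_nonneg.2 hX)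
  nlinarith

/-- Both `kp` and `kq` increase strictly with `k`, so their sum determines `k`. -/
lemma Balance.unique_of_total (h : Balance a b c e ψ₁ ψ₂ k p q)
    (h' : Balance a b c e ψ₁ ψ₂ k' p' q') (ha : 0 ≤ a) (hb : 0 ≤ b) (hc : 0 < c) (he : 0 < e)
    (hψ₁ : 0 < ψ₁) (hψ₂ : 0 < ψ₂) (hk : k * (p + q) = k' * (p' + q')) :
    k = k' ∧ p = p' ∧ q = q' := by
  have hkk : k = k' := by
    rcases lt_trichotomy k k' with hlt | heq | hgt
    · have := h.rate_lt h' ha hb hc he hψ₁ hψ₂.le hlt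
      have := h.swap.rate_lt h'.swap hb ha he hc hψ₂ hψ₁.le hlt
      linarith
    · exact heq
    · have := h'.rate_lt h ha hb hc he hψ₁ hψ₂.le hgt
      have := h'.swap.rate_lt h.swap hb ha he hc hψ₂ hψ₁.le hgt
      linarith
  subst hkk
  exact ⟨rfl, h.unique h' ha hb hc he hψ₁.le hψ₂.le⟩

lemma Balance.le_p (h : Balance a b c e ψ₁ ψ₂ k p q) (ha : 0 ≤ a) (hb : 0 ≤ b) :
    ψ₁ ≤ p * (k + c + a) := by
  have hp := h.p_nonneg
  have hq := h.q_nonneg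
  have : a * p / (1 + a * p + b * q) ≤ a * p :=
    div_le_self (by positivity) (by nlinarith [mul_nonneg ha hp, mul_nonneg hb hq])
  linarith [h.eq₁]

lemma Balance.p_pos (h : Balance a b c e ψ₁ ψ₂ k p q) (ha : 0 ≤ a) (hb : 0 ≤ b)
    (hψ₁ : 0 < ψ₁) : 0 < p := by
  rcases h.p_nonneg.eq_or_lt with h0 | h0
  · have := h.le_p ha hb
    rw [← h0] at this
    linarith
  · exact h0

lemma Balance.c_mul_p_le (h : Balance a b c e ψ₁ ψ₂ k p q) (ha : 0 ≤ a) (hb : 0 ≤ b) :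
    c * p ≤ ψ₁ := by
  have hp := h.p_nonneg
  have hq := h.q_nonneg
  have hk := h.k_nonneg
  have : 0 ≤ k * p := by positivity
  have : 0 ≤ a * p / (1 + a * p + b * q) := by positivity
  linarith [h.eq₁]

end Balance

/-! ### The ridgeless limit -/

section Limits

variable {a b c e F τ ψ₁ ψ₂ ψ₃ : ℝ}

lemma Reduced.balance {lam t₁ t₂ t₃ p q : ℝ}
    (h : Reduced a b c e ψ₁ ψ₂ ψ₃ lam t₁ t₂ t₃ p q) (hlam : 0 < lam) :
    Balance a b c e ψ₁ ψ₂ (lam / t₃) p q ∧ lam / t₃ * p = t₁ ∧ lam / t₃ * q = t₂ := by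
  have h3 := h.t₃_pos
  have e1 : lam / t₃ * p = t₁ := by
    rw [div_mul_eq_mul_div, ← h.mul₁₃, mul_div_cancel_right₀ _ h3.ne']
  have e2 : lam / t₃ * q = t₂ := by
    rw [div_mul_eq_mul_div, ← h.mul₂₃, mul_div_cancel_right₀ _ h3.ne']
  refine ⟨⟨by positivity, h.p_pos.le, h.q_pos.le, ?_, ?_⟩, e1, e2⟩
  · rw [e1]; exact h.eq₁
  · rw [e2]; exact h.eq₂

/-- All couplings cancel in the first equation plus the second minus the third. The sign of `ψ₁ + ψ₂
- ψ₃` thereby decides which killing rates survive. -/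
lemma Reduced.total {lam t₁ t₂ t₃ p q : ℝ}
    (h : Reduced a b c e ψ₁ ψ₂ ψ₃ lam t₁ t₂ t₃ p q) : t₁ + t₂ = ψ₁ + ψ₂ - ψ₃ + t₃ := by
  have e1 := h.eq₁
  have e2 := h.eq₂
  have e3 := h.eq₃
  rw [add_div] at e3
  linarith

lemma Reduced.bounds {lam t₁ t₂ t₃ p q : ℝ}
    (h : Reduced a b c e ψ₁ ψ₂ ψ₃ lam t₁ t₂ t₃ p q) (hlam : 0 < lam) (ha : 0 ≤ a) (hb : 0 ≤ b)
    (hc : 0 < c) (he : 0 < e) : p ≤ ψ₁ / c ∧ q ≤ ψ₂ / e := by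
  have hbal := (h.balance hlam).1
  constructor
  · rw [le_div_iff₀ hc]; linarith [hbal.c_mul_p_le ha hb]
  · rw [le_div_iff₀ he]; linarith [hbal.swap.c_mul_p_le hb ha]

/-- The map defining `Balance`, together with the total killing rate. -/
noncomputable def balanceMap (a b c e : ℝ) (v : ℝ × ℝ × ℝ) : ℝ × ℝ × ℝ :=
  (v.1 * v.2.1 + c * v.2.1 + a * v.2.1 / (1 + a * v.2.1 + b * v.2.2),
    v.1 * v.2.2 + e * v.2.2 + b * v.2.2 / (1 + a * v.2.1 + b * v.2.2),
    v.1 * (v.2.1 + v.2.2))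

lemma continuousAt_balanceMap {v : ℝ × ℝ × ℝ} (hv : 1 + a * v.2.1 + b * v.2.2 ≠ 0) :
    ContinuousAt (balanceMap a b c e) v := by
  unfold balanceMap
  fun_prop (disch := assumption)

variable {t₁ t₂ t₃ p q : ℝ → ℝ}

lemma tendsto_reducedRisk {ι : Type*} {l : Filter ι} {t₁ t₂ t₃ p q : ι → ℝ} {s₁ s₂ s₃ p₀ q₀ D : ℝ}
    (h1 : Tendsto t₁ l (𝓝 s₁)) (h2 : Tendsto t₂ l (𝓝 s₂)) (h3 : Tendsto t₃ l (𝓝 s₃))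
    (hp : Tendsto p l (𝓝 p₀)) (hq : Tendsto q l (𝓝 q₀))
    (hDe : D = 1 + a * p₀ + b * q₀) (hD : D ≠ 0)
    (hd : lapDet s₁ s₂ s₃ (a * p₀ * (b * q₀) / D ^ 2) (c * p₀ + a * p₀ / D ^ 2)
      (e * q₀ + b * q₀ / D ^ 2) ≠ 0) :
    Tendsto (fun i => reducedRisk a b c e F τ (t₁ i) (t₂ i) (t₃ i) (p i) (q i)) l
      (𝓝 (reducedRisk a b c e F τ s₁ s₂ s₃ p₀ q₀)) := by
  have hc : ContinuousAt (fun v : ℝ × ℝ × ℝ × ℝ × ℝ =>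
      reducedRisk a b c e F τ v.1 v.2.1 v.2.2.1 v.2.2.2.1 v.2.2.2.2) (s₁, s₂, s₃, p₀, q₀) :=
    continuousAt_reducedRisk hDe hD hd
  have ht : Tendsto (fun i => (t₁ i, t₂ i, t₃ i, p i, q i)) l (𝓝 (s₁, s₂, s₃, p₀, q₀)) :=
    h1.prodMk_nhds (h2.prodMk_nhds (h3.prodMk_nhds (hp.prodMk_nhds hq)))
  have := Tendsto.comp hc ht
  simpa only [Function.comp_def] using this

/-- The determinant is positive in the limit as soon as some killing rate survives. -/
lemma Balance.lapDet_pos {k p q D s₁ s₂ s₃ : ℝ} (h : Balance a b c e ψ₁ ψ₂ k p q)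
    (ha : 0 ≤ a) (hb : 0 ≤ b) (hc : 0 < c) (he : 0 < e) (hψ₁ : 0 < ψ₁) (hψ₂ : 0 < ψ₂)
    (h1 : 0 ≤ s₁) (h2 : 0 ≤ s₂) (h3 : 0 ≤ s₃)
    (hs : 0 < s₁ + s₂ + s₃) :
    0 < lapDet s₁ s₂ s₃ (a * p * (b * q) / D ^ 2) (c * p + a * p / D ^ 2)
      (e * q + b * q / D ^ 2) := by
  have hp := h.p_pos ha hb hψ₁
  have hq := h.swap.p_pos hb ha hψ₂
  exact DRFMParams.lapDet_pos h1 h2 h3 hs (by positivity) (by positivity) (by positivity)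

/-- Since `t₁ + t₂ ≥ δ > 0` and `t₃ (t₁ + t₂) = λ (p + q) = O(λ)`, the rate `t₃` vanishes. The
triple `(λ/t₃, p, q)` stays in a compact set, and `Balance` with total rate `δ` has only one
solution. -/
theorem tendsto_over (ha : 0 ≤ a) (hb : 0 ≤ b) (hc : 0 < c) (he : 0 < e) (hψ₁ : 0 < ψ₁)
    (hψ₂ : 0 < ψ₂) (hψ₃ : 0 < ψ₃) (hψ : ψ₃ < ψ₁ + ψ₂)
    (h : ∀ lam, 0 < lam →
      Reduced a b c e ψ₁ ψ₂ ψ₃ lam (t₁ lam) (t₂ lam) (t₃ lam) (p lam) (q lam)) :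
    ∃ k p₀ q₀, 0 < k ∧ Balance a b c e ψ₁ ψ₂ k p₀ q₀ ∧ k * (p₀ + q₀) = ψ₁ + ψ₂ - ψ₃ ∧
      Tendsto (fun lam => reducedRisk a b c e F τ (t₁ lam) (t₂ lam) (t₃ lam) (p lam) (q lam))
        (𝓝[>] 0) (𝓝 (reducedRisk a b c e F τ (k * p₀) (k * q₀) 0 p₀ q₀)) := by
  set δ := ψ₁ + ψ₂ - ψ₃ with hδdef
  have hδ : 0 < δ := by linarith
  have hev : ∀ᶠ lam : ℝ in 𝓝[>] 0, 0 < lam := self_mem_nhdsWithin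
  have hlam0 : Tendsto (fun lam : ℝ => lam) (𝓝[>] 0) (𝓝 0) := nhdsWithin_le_nhds
  set m := ψ₁ / c + ψ₂ / e with hm
  have hm0 : 0 < m := by positivity
  have ht3 : Tendsto t₃ (𝓝[>] 0) (𝓝 0) := by
    have hup : Tendsto (fun lam : ℝ => lam * (m / δ)) (𝓝[>] 0) (𝓝 0) := by
      simpa using hlam0.mul_const (m / δ)
    refine squeeze_zero' (hev.mono fun lam hl => (h lam hl).t₃_pos.le)
      (hev.mono fun lam hl => ?_) hup
    have hr := h lam hl
    obtain ⟨b1, b2⟩ := hr.bounds hl ha hb hc he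
    have htot := hr.total
    have h3 := hr.t₃_pos
    have := hr.mul₁₃
    have := hr.mul₂₃
    rw [← mul_div_assoc, le_div_iff₀ hδ]
    have i1 : t₃ lam * δ ≤ t₃ lam * (t₁ lam + t₂ lam) :=
      mul_le_mul_of_nonneg_left (by linarith) h3.le
    have i2 : lam * (p lam + q lam) ≤ lam * m := mul_le_mul_of_nonneg_left (by linarith) hl.le
    linarith
  set s := a + b + c + e with hs
  have hs0 : 0 < s := by positivity
  -- Bounds `k = λ/t₃`: `k (p + q) = δ + t₃ ≤ δ + ψ₃`, and once `t₃ < ψ₃ / 2` the third equation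
  -- gives `ψ₃ / 2 ≤ s (p + q)`.
  set κ := (δ + ψ₃) * (s / (ψ₃ / 2)) with hκ
  set K : Set (ℝ × ℝ × ℝ) := Set.Icc 0 κ ×ˢ Set.Icc 0 (ψ₁ / c) ×ˢ Set.Icc 0 (ψ₂ / e)
  have hK : IsCompact K := isCompact_Icc.prod (isCompact_Icc.prod isCompact_Icc)
  have hden : ∀ v ∈ K, 1 + a * v.2.1 + b * v.2.2 ≠ 0 := by
    rintro v ⟨-, hv1, hv2⟩
    have := hv1.1
    have := hv2.1
    positivity
  have hmem : ∀ᶠ lam in 𝓝[>] 0, (lam / t₃ lam, p lam, q lam) ∈ K := by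
    filter_upwards [hev, ht3.eventually (gt_mem_nhds (half_pos hψ₃))] with lam hl hl3
    have hr := h lam hl
    obtain ⟨hbal, k1, k2⟩ := hr.balance hl
    obtain ⟨b1, b2⟩ := hr.bounds hl ha hb hc he
    have hp := hr.p_pos
    have hq := hr.q_pos
    refine ⟨⟨hbal.k_nonneg, ?_⟩, ⟨hp.le, b1⟩, ⟨hq.le, b2⟩⟩
    have htot := hr.total
    have e3 := hr.eq₃
    have l1 : ψ₃ / 2 ≤ s * (p lam + q lam) := by
      have : (a * p lam + b * q lam) / (1 + a * p lam + b * q lam) ≤ a * p lam + b * q lam :=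
        div_le_self (by positivity)
          (by nlinarith [mul_nonneg ha hp.le, mul_nonneg hb hq.le])
      have : 0 ≤ (a + c) * q lam := by positivity
      have : 0 ≤ (b + e) * p lam := by positivity
      nlinarith
    have l2 : lam / t₃ lam * (p lam + q lam) ≤ δ + ψ₃ := by
      rw [mul_add, k1, k2, htot]; linarith
    have l3 : 1 ≤ s * (p lam + q lam) / (ψ₃ / 2) := by
      rw [one_le_div (half_pos hψ₃)]; exact l1
    calc lam / t₃ lam ≤ lam / t₃ lam * (s * (p lam + q lam) / (ψ₃ / 2)) :=
          le_mul_of_one_le_right hbal.k_nonneg l3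
      _ = lam / t₃ lam * (p lam + q lam) * (s / (ψ₃ / 2)) := by ring
      _ ≤ _ := by rw [hκ]; gcongr
  have hlim : Tendsto (fun lam => balanceMap a b c e (lam / t₃ lam, p lam, q lam)) (𝓝[>] 0)
      (𝓝 (ψ₁, ψ₂, δ)) := by
    have : Tendsto (fun lam => (ψ₁, ψ₂, δ + t₃ lam)) (𝓝[>] 0) (𝓝 (ψ₁, ψ₂, δ)) := by
      refine tendsto_const_nhds.prodMk_nhds (tendsto_const_nhds.prodMk_nhds ?_)
      simpa using ht3.const_add δ
    refine this.congr' (hev.mono fun lam hl => ?_)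
    have hr := h lam hl
    obtain ⟨hbal, k1, k2⟩ := hr.balance hl
    have htot := hr.total
    simp only [balanceMap]
    rw [hbal.eq₁, hbal.eq₂, mul_add, k1, k2, htot]
  have hB : ∀ v ∈ K, balanceMap a b c e v = (ψ₁, ψ₂, δ) →
      Balance a b c e ψ₁ ψ₂ v.1 v.2.1 v.2.2 ∧ v.1 * (v.2.1 + v.2.2) = δ := by
    rintro v ⟨hv0, hv1, hv2⟩ hv
    simp only [balanceMap, Prod.mk.injEq] at hv
    exact ⟨⟨hv0.1, hv1.1, hv2.1, hv.1, hv.2.1⟩, hv.2.2⟩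
  obtain ⟨y, hyK, hy, hty⟩ := exists_tendsto_of_isCompact hK
    (fun v hv => continuousAt_balanceMap (hden v hv)) hmem hlim (by
      intro v hv v' hv' e1 e2
      obtain ⟨b1, d1⟩ := hB v hv e1
      obtain ⟨b2, d2⟩ := hB v' hv' e2
      obtain ⟨x1, x2, x3⟩ := b1.unique_of_total b2 ha hb hc he hψ₁ hψ₂ (d1.trans d2.symm)
      exact Prod.ext x1 (Prod.ext x2 x3))
  obtain ⟨hbal, htot⟩ := hB y hyK hy
  have hkt : Tendsto (fun lam => lam / t₃ lam) (𝓝[>] 0) (𝓝 y.1) :=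
    (continuous_fst.tendsto _).comp hty
  have hpt : Tendsto p (𝓝[>] 0) (𝓝 y.2.1) :=
    ((continuous_fst.comp continuous_snd).tendsto _).comp hty
  have hqt : Tendsto q (𝓝[>] 0) (𝓝 y.2.2) :=
    ((continuous_snd.comp continuous_snd).tendsto _).comp hty
  have hk0 : 0 < y.1 := by
    refine hbal.k_nonneg.lt_of_ne fun h0 => ?_
    rw [← h0, zero_mul] at htot
    linarith
  have ht1 : Tendsto t₁ (𝓝[>] 0) (𝓝 (y.1 * y.2.1)) :=
    (hkt.mul hpt).congr' (hev.mono fun lam hl => ((h lam hl).balance hl).2.1)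
  have ht2 : Tendsto t₂ (𝓝[>] 0) (𝓝 (y.1 * y.2.2)) :=
    (hkt.mul hqt).congr' (hev.mono fun lam hl => ((h lam hl).balance hl).2.2)
  refine ⟨y.1, y.2.1, y.2.2, hk0, hbal, htot, ?_⟩
  refine tendsto_reducedRisk ht1 ht2 ht3 hpt hqt rfl (hbal.den_pos ha hb).ne' ?_
  have g1 := mul_nonneg hbal.k_nonneg hbal.p_nonneg
  have g2 := mul_nonneg hbal.k_nonneg hbal.q_nonneg
  exact (hbal.lapDet_pos ha hb hc he hψ₁ hψ₂ g1 g2 le_rfl (by linarith)).ne'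

/-- Here `t₁ + t₂ ≤ t₃`, so `t₁² ≤ t₁t₃ = λp = O(λ)`, and likewise for `t₂`. Equality `ψ₁ + ψ₂ = ψ₃`
is admitted, so that the threshold is covered. -/
theorem tendsto_under (ha : 0 ≤ a) (hb : 0 ≤ b) (hc : 0 < c) (he : 0 < e) (hψ₁ : 0 < ψ₁)
    (hψ₂ : 0 < ψ₂) (hψ : ψ₁ + ψ₂ ≤ ψ₃)
    (h : ∀ lam, 0 < lam →
      Reduced a b c e ψ₁ ψ₂ ψ₃ lam (t₁ lam) (t₂ lam) (t₃ lam) (p lam) (q lam)) :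
    ∃ p₀ q₀, Balance a b c e ψ₁ ψ₂ 0 p₀ q₀ ∧ Tendsto p (𝓝[>] 0) (𝓝 p₀) ∧
      Tendsto q (𝓝[>] 0) (𝓝 q₀) ∧ Tendsto t₁ (𝓝[>] 0) (𝓝 0) ∧ Tendsto t₂ (𝓝[>] 0) (𝓝 0) ∧
      Tendsto t₃ (𝓝[>] 0) (𝓝 (ψ₃ - ψ₁ - ψ₂)) := by
  have hev : ∀ᶠ lam : ℝ in 𝓝[>] 0, 0 < lam := self_mem_nhdsWithin
  have hlam0 : Tendsto (fun lam : ℝ => lam) (𝓝[>] 0) (𝓝 0) := nhdsWithin_le_nhds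
  have hsq : ∀ m : ℝ, Tendsto (fun lam : ℝ => Real.sqrt (lam * m)) (𝓝[>] 0) (𝓝 0) := by
    intro m
    have := (Real.continuous_sqrt.tendsto _).comp (hlam0.mul_const m)
    rwa [zero_mul, Real.sqrt_zero] at this
  have ht1 : Tendsto t₁ (𝓝[>] 0) (𝓝 0) := by
    refine squeeze_zero' (hev.mono fun lam hl => (h lam hl).t₁_pos.le)
      (hev.mono fun lam hl => ?_) (hsq (ψ₁ / c))
    have hr := h lam hl
    obtain ⟨b1, b2⟩ := hr.bounds hl ha hb hc he
    apply Real.le_sqrt_of_sq_le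
    have i1 : t₁ lam * t₁ lam ≤ t₁ lam * t₃ lam :=
      mul_le_mul_of_nonneg_left (by linarith [hr.total, hr.t₂_pos]) hr.t₁_pos.le
    have i2 : lam * p lam ≤ lam * (ψ₁ / c) := mul_le_mul_of_nonneg_left b1 hl.le
    linarith [hr.mul₁₃]
  have ht2 : Tendsto t₂ (𝓝[>] 0) (𝓝 0) := by
    refine squeeze_zero' (hev.mono fun lam hl => (h lam hl).t₂_pos.le)
      (hev.mono fun lam hl => ?_) (hsq (ψ₂ / e))
    have hr := h lam hl
    obtain ⟨b1, b2⟩ := hr.bounds hl ha hb hc he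
    apply Real.le_sqrt_of_sq_le
    have i1 : t₂ lam * t₂ lam ≤ t₂ lam * t₃ lam :=
      mul_le_mul_of_nonneg_left (by linarith [hr.total, hr.t₁_pos]) hr.t₂_pos.le
    have i2 : lam * q lam ≤ lam * (ψ₂ / e) := mul_le_mul_of_nonneg_left b2 hl.le
    linarith [hr.mul₂₃]
  have ht3 : Tendsto t₃ (𝓝[>] 0) (𝓝 (ψ₃ - ψ₁ - ψ₂)) := by
    have := (ht1.add ht2).add_const (ψ₃ - ψ₁ - ψ₂)
    rw [add_zero, zero_add] at this
    exact this.congr' (hev.mono fun lam hl => by linarith [(h lam hl).total])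
  -- The rate is frozen at `0`: the vanishing `t₁`, `t₂` are moved to the right-hand sides `ψ₁ -
  -- t₁`, `ψ₂ - t₂`.
  set K : Set (ℝ × ℝ × ℝ) := {0} ×ˢ Set.Icc 0 (ψ₁ / c) ×ˢ Set.Icc 0 (ψ₂ / e)
  have hK : IsCompact K := isCompact_singleton.prod (isCompact_Icc.prod isCompact_Icc)
  have hden : ∀ v ∈ K, 1 + a * v.2.1 + b * v.2.2 ≠ 0 := by
    rintro v ⟨-, hv1, hv2⟩
    have := hv1.1
    have := hv2.1
    positivity
  have hmem : ∀ᶠ lam in 𝓝[>] 0, ((0 : ℝ), p lam, q lam) ∈ K := by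
    filter_upwards [hev] with lam hl
    have hr := h lam hl
    obtain ⟨b1, b2⟩ := hr.bounds hl ha hb hc he
    exact ⟨rfl, ⟨hr.p_pos.le, b1⟩, ⟨hr.q_pos.le, b2⟩⟩
  have hlim : Tendsto (fun lam => balanceMap a b c e (0, p lam, q lam)) (𝓝[>] 0)
      (𝓝 (ψ₁, ψ₂, 0)) := by
    have : Tendsto (fun lam => (ψ₁ - t₁ lam, ψ₂ - t₂ lam, (0 : ℝ))) (𝓝[>] 0)
        (𝓝 (ψ₁, ψ₂, 0)) := by
      refine Tendsto.prodMk_nhds ?_ (Tendsto.prodMk_nhds ?_ tendsto_const_nhds)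
      · simpa using ht1.const_sub ψ₁
      · simpa using ht2.const_sub ψ₂
    refine this.congr' (hev.mono fun lam hl => ?_)
    have hr := h lam hl
    simp only [balanceMap, zero_mul, zero_add, Prod.mk.injEq, and_true]
    exact ⟨by linarith [hr.eq₁], by linarith [hr.eq₂]⟩
  have hB : ∀ v ∈ K, balanceMap a b c e v = (ψ₁, ψ₂, 0) →
      Balance a b c e ψ₁ ψ₂ 0 v.2.1 v.2.2 ∧ v.1 = 0 := by
    rintro v ⟨hv0, hv1, hv2⟩ hv
    have hv0 : v.1 = 0 := hv0
    simp only [balanceMap, Prod.mk.injEq, hv0] at hv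
    exact ⟨⟨le_rfl, hv1.1, hv2.1, hv.1, hv.2.1⟩, hv0⟩
  obtain ⟨y, hyK, hy, hty⟩ := exists_tendsto_of_isCompact hK
    (fun v hv => continuousAt_balanceMap (hden v hv)) hmem hlim (by
      intro v hv v' hv' e1 e2
      obtain ⟨b1, d1⟩ := hB v hv e1
      obtain ⟨b2, d2⟩ := hB v' hv' e2
      obtain ⟨x2, x3⟩ := b1.unique b2 ha hb hc he hψ₁.le hψ₂.le
      exact Prod.ext (d1.trans d2.symm) (Prod.ext x2 x3))
  exact ⟨y.2.1, y.2.2, (hB y hyK hy).1, ((continuous_fst.comp continuous_snd).tendsto _).comp hty,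
    ((continuous_snd.comp continuous_snd).tendsto _).comp hty, ht1, ht2, ht3⟩

/-- At the interpolation threshold all killing rates vanish and the risk explodes. -/
theorem tendsto_threshold (hF : 0 < F) (ha : 0 ≤ a) (hb : 0 ≤ b) (hc : 0 < c) (he : 0 < e)
    (hψ₁ : 0 < ψ₁) (hψ₂ : 0 < ψ₂) (hψ : ψ₁ + ψ₂ = ψ₃)
    (h : ∀ lam, 0 < lam →
      Reduced a b c e ψ₁ ψ₂ ψ₃ lam (t₁ lam) (t₂ lam) (t₃ lam) (p lam) (q lam)) :
    Tendsto (fun lam => reducedRisk a b c e F τ (t₁ lam) (t₂ lam) (t₃ lam) (p lam) (q lam))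
      (𝓝[>] 0) atTop := by
  have hev : ∀ᶠ lam : ℝ in 𝓝[>] 0, 0 < lam := self_mem_nhdsWithin
  obtain ⟨p₀, q₀, hbal, hp, hq, h1, h2, h3⟩ := tendsto_under ha hb hc he hψ₁ hψ₂ hψ.le h
  rw [show ψ₃ - ψ₁ - ψ₂ = 0 by linarith] at h3
  have hp₀ := hbal.p_pos ha hb hψ₁
  have hq₀ := hbal.swap.p_pos hb ha hψ₂
  have hD₀ := hbal.den_pos ha hb
  have hD : Tendsto (fun lam => 1 + a * p lam + b * q lam) (𝓝[>] 0) (𝓝 (1 + a * p₀ + b * q₀)) :=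
    ((hp.const_mul a).const_add 1).add (hq.const_mul b)
  have hD2 := hD.pow 2
  have hD2' := (pow_pos hD₀ 2).ne'
  have hw12 := ((hp.const_mul a).mul (hq.const_mul b)).div hD2 hD2'
  have hw13 := (hp.const_mul c).add ((hp.const_mul a).div hD2 hD2')
  have hw23 := (hq.const_mul e).add ((hq.const_mul b).div hD2 hD2')
  set D : ℝ → ℝ := fun lam => 1 + a * p lam + b * q lam with hDdef
  set w₁₂ : ℝ → ℝ := fun lam => a * p lam * (b * q lam) / D lam ^ 2 with hw12def
  set w₁₃ : ℝ → ℝ := fun lam => c * p lam + a * p lam / D lam ^ 2 with hw13def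
  set w₂₃ : ℝ → ℝ := fun lam => e * q lam + b * q lam / D lam ^ 2 with hw23def
  have hw12 : Tendsto w₁₂ (𝓝[>] 0) (𝓝 _) := hw12
  have hw13 : Tendsto w₁₃ (𝓝[>] 0) (𝓝 _) := hw13
  have hw23 : Tendsto w₂₃ (𝓝[>] 0) (𝓝 _) := hw23
  have hd : Tendsto (fun lam => D lam ^ 2 *
      lapDet (t₁ lam) (t₂ lam) (t₃ lam) (w₁₂ lam) (w₁₃ lam) (w₂₃ lam)) (𝓝[>] 0) (𝓝 0) := by
    have := hD2.mul ((((((h1.mul h2).mul h3).add ((h1.mul h2).mul (hw13.add hw23))).add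
      ((h1.mul h3).mul (hw12.add hw23))).add ((h2.mul h3).mul (hw12.add hw13))).add
      (((h1.add h2).add h3).mul (((hw12.mul hw13).add (hw12.mul hw23)).add (hw13.mul hw23))))
    simp only [mul_zero, zero_mul, add_zero] at this
    exact this
  have hdpos : ∀ lam, 0 < lam → 0 < D lam ∧
      0 < lapDet (t₁ lam) (t₂ lam) (t₃ lam) (w₁₂ lam) (w₁₃ lam) (w₂₃ lam) := by
    intro lam hl
    have hr := h lam hl
    have := hr.t₁_pos
    have := hr.t₂_pos
    have := hr.t₃_pos
    have hb' := (hr.balance hl).1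
    exact ⟨hb'.den_pos ha hb, hb'.lapDet_pos ha hb hc he hψ₁ hψ₂
      hr.t₁_pos.le hr.t₂_pos.le hr.t₃_pos.le (by positivity)⟩
  have hdinv : Tendsto (fun lam => (D lam ^ 2 *
      lapDet (t₁ lam) (t₂ lam) (t₃ lam) (w₁₂ lam) (w₁₃ lam) (w₂₃ lam))⁻¹) (𝓝[>] 0) atTop := by
    refine tendsto_inv_nhdsGT_zero.comp (tendsto_nhdsWithin_iff.2 ⟨hd, hev.mono fun lam hl => ?_⟩)
    exact mul_pos (pow_pos (hdpos lam hl).1 2) (hdpos lam hl).2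
  -- The numerator of the lower bound has a positive limit, while `D²` times the determinant tends
  -- to `0` from above.
  have hnum := ((hp.const_mul c).mul ((hw13.mul h2).add (hw13.mul hw23))).const_mul (F ^ 2)
  refine tendsto_atTop_mono' _ (hev.mono fun lam hl => ?_) (hnum.pos_mul_atTop ?_ hdinv)
  · have hr := h lam hl
    refine le_trans (le_of_eq ?_) (le_reducedRisk ha hb hc.le he.le hr.t₁_pos.le hr.t₂_pos.le
      hr.t₃_pos.le hr.p_pos.le hr.q_pos.le rfl rfl rfl rfl (hdpos lam hl).2)
    simp only [hDdef, hw12def, hw13def, hw23def]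
    ring
  · positivity

end Limits

/-! ### Degeneration of the second activation -/

section VanishingSecondActivation

variable {a b c e F τ ψ₁ ψ₂ ψ₃ : ℝ}

/-- Between the thresholds, the ridgeless risk stays bounded when the second activation degenerates
along `μ₂₁ = 0`. -/
lemma exists_reducedRisk_le (ha : 0 ≤ a) (hc : 0 < c) (hψ₁ : 0 < ψ₁) (hψ₂ : 0 < ψ₂)
    (h13 : ψ₁ < ψ₃) (hψ : ψ₃ < ψ₁ + ψ₂) : ∃ C, ∀ e k p q, 0 < e → e ≤ 1 →
      Balance a 0 c e ψ₁ ψ₂ k p q → k * (p + q) = ψ₁ + ψ₂ - ψ₃ →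
      reducedRisk a 0 c e F τ (k * p) (k * q) 0 p q ≤ C := by
  have hδ : 0 < ψ₃ - ψ₁ := sub_pos.2 h13
  -- A bound for `k` uniform in `e ≤ 1`: `k (ψ₃ - ψ₁) ≤ k (eq) ≤ kq ≤ ψ₂`.
  set κ := ψ₂ / (ψ₃ - ψ₁)
  have hκ : 0 < κ := by positivity
  set p₁ := ψ₁ / (κ + c + a)
  have hp₁ : 0 < p₁ := by positivity
  set K : Set (ℝ × ℝ × ℝ × ℝ × ℝ) := (Set.Icc 0 ψ₁ ×ˢ Set.Icc 0 ψ₂ ×ˢ {0} ×ˢ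
    Set.Icc p₁ (ψ₁ / c) ×ˢ Set.Icc (ψ₃ - ψ₁) ψ₂) ∩ {v | v.1 + v.2.1 = ψ₁ + ψ₂ - ψ₃} with hKdef
  have hK : IsCompact K := by
    refine IsCompact.inter_right (isCompact_Icc.prod (isCompact_Icc.prod
      (isCompact_singleton.prod (isCompact_Icc.prod isCompact_Icc)))) ?_
    exact isClosed_eq (by fun_prop) continuous_const
  have hcont : ContinuousOn (fun v : ℝ × ℝ × ℝ × ℝ × ℝ =>
      reducedRisk a 0 c 1 F τ v.1 v.2.1 v.2.2.1 v.2.2.2.1 v.2.2.2.2) K := by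
    rintro v ⟨⟨h1, h2, h3, h4, h5⟩, hv⟩
    have h3 : v.2.2.1 = 0 := h3
    have hv : v.1 + v.2.1 = ψ₁ + ψ₂ - ψ₃ := hv
    have hp := hp₁.trans_le h4.1
    have hq := hδ.trans_le h5.1
    refine ContinuousAt.continuousWithinAt (continuousAt_reducedRisk rfl ?_ ?_)
    · positivity
    · refine (lapDet_pos h1.1 h2.1 h3.ge ?_ ?_ ?_ ?_).ne'
      · rw [hv, h3]; linarith
      · positivity
      · positivity
      · positivity
  obtain ⟨C, hC⟩ := hK.bddAbove_image hcont
  refine ⟨C, fun e k p q he he1 hbal htot => ?_⟩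
  -- For `b = 0` the risk sees `e` and `q` only through `eq`, apart from the killing rates. This
  -- product lies in `[ψ₃ - ψ₁, ψ₂]`, although `q` is unbounded as `e → 0`.
  have hsimp : reducedRisk a 0 c e F τ (k * p) (k * q) 0 p q =
      reducedRisk a 0 c 1 F τ (k * p) (k * q) 0 p (e * q) := by
    simp only [reducedRisk, zero_mul, one_mul]
  rw [hsimp]
  refine hC ⟨(k * p, k * q, 0, p, e * q), ⟨⟨?_, ?_, rfl, ?_, ?_⟩, ?_⟩, rfl⟩
  all_goals
    have hk := hbal.k_nonneg
    have hp := hbal.p_nonneg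
    have hq := hbal.q_nonneg
    have e1 := hbal.eq₁
    have e2 := hbal.eq₂
    rw [zero_mul, zero_div, add_zero] at e2
    have hkp : 0 ≤ k * p := by positivity
    have hkq : 0 ≤ k * q := by positivity
    have hcp : 0 ≤ c * p := by positivity
    have heq : 0 ≤ e * q := by positivity
    have hα : 0 ≤ a * p / (1 + a * p + 0 * q) := by positivity
    have hε : ψ₃ - ψ₁ ≤ e * q := by linarith
  · exact ⟨hkp, by linarith⟩
  · exact ⟨hkq, by linarith⟩
  · refine ⟨?_, ?_⟩
    · have hkκ : k ≤ κ := by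
        rw [le_div_iff₀ hδ]
        have : k * (ψ₃ - ψ₁) ≤ k * (e * q) := mul_le_mul_of_nonneg_left hε hk
        have : e * (k * q) ≤ 1 * (k * q) := mul_le_mul_of_nonneg_right he1 hkq
        linarith
      rw [div_le_iff₀ (by positivity)]
      refine (hbal.le_p ha le_rfl).trans ?_
      gcongr
    · rw [le_div_iff₀ hc]; linarith
  · exact ⟨hε, by linarith⟩
  · change k * p + k * q = _
    linarith

/-- With total rate `ψ₂`, the second equation gives `kp = eq + bq/D ≤ (b + e) q`. Multiplying by `k`
and using `kq ≤ ψ₂` bounds `k²p`, and `p` is bounded below by `le_p`. -/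
lemma Balance.rate_sq_le {k p q : ℝ} (h : Balance a b c e ψ₁ ψ₂ k p q) (ha : 0 ≤ a) (hb : 0 ≤ b)
    (hc : 0 < c) (he : 0 < e) (htot : k * (p + q) = ψ₂) :
    k ^ 2 * ψ₁ ≤ (b + e) * ψ₂ * (k + c + a) := by
  have hk := h.k_nonneg
  have hp := h.p_nonneg
  have hq := h.q_nonneg
  have hkp : k * p ≤ (b + e) * q := by
    have : b * q / (1 + a * p + b * q) ≤ b * q :=
      div_le_self (by positivity) (by nlinarith [mul_nonneg ha hp, mul_nonneg hb hq])
    linarith [h.eq₂]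
  have hkq : k * q ≤ ψ₂ := by linarith [mul_nonneg hk hp]
  have h1 : k ^ 2 * p ≤ (b + e) * ψ₂ := by
    have := mul_le_mul_of_nonneg_left hkp hk
    have := mul_le_mul_of_nonneg_left hkq (by positivity : 0 ≤ b + e)
    linarith
  have h2 := mul_le_mul_of_nonneg_left (h.le_p ha hb) (sq_nonneg k)
  have h3 := mul_le_mul_of_nonneg_right h1 (by positivity : 0 ≤ k + c + a)
  linarith

lemma Balance.rate_le {k p q C : ℝ} (h : Balance a b c e ψ₁ ψ₂ k p q) (ha : 0 ≤ a) (hb : 0 ≤ b)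
    (hc : 0 < c) (he : 0 < e) (hψ₁ : 0 < ψ₁) (hψ₂ : 0 < ψ₂) (htot : k * (p + q) = ψ₂)
    (hC : C = ψ₂ * (1 + c + a) / ψ₁) (hsmall : (b + e) * C ≤ 1) :
    k ≤ Real.sqrt ((b + e) * C) := by
  have hk := h.k_nonneg
  have hsq := h.rate_sq_le ha hb hc he htot
  have hCψ : (b + e) * C * ψ₁ = (b + e) * ψ₂ * (1 + c + a) := by rw [hC]; field_simp
  have hρ : 0 < (b + e) * ψ₂ := by positivity
  -- A first rough bound, which replaces `k + c + a` by `1 + c + a` in the quadratic inequality.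
  have hk1 : k ≤ 1 := by
    by_contra hk1
    push Not at hk1
    have h1 : (b + e) * ψ₂ * (k + c + a) < (b + e) * ψ₂ * (1 + c + a) * k ^ 2 := by
      have hk2 : k < k ^ 2 := by nlinarith
      have hca : (c + a) * 1 ≤ (c + a) * k ^ 2 :=
        mul_le_mul_of_nonneg_left (hk1.le.trans hk2.le) (by positivity)
      rw [mul_assoc _ (1 + c + a)]
      exact mul_lt_mul_of_pos_left (by linarith) hρ
    have h2 : (b + e) * C * ψ₁ * k ^ 2 ≤ 1 * ψ₁ * k ^ 2 := by gcongr
    rw [hCψ] at h2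
    linarith
  apply Real.le_sqrt_of_sq_le
  have : (b + e) * ψ₂ * (k + c + a) ≤ (b + e) * ψ₂ * (1 + c + a) := by gcongr
  nlinarith

/-- At the second threshold, the ridgeless risk is at least of the order of the inverse of the
first killing rate. -/
lemma le_reducedRisk_second_threshold {k p q : ℝ} (h : Balance a b c e ψ₁ ψ₂ k p q) (ha : 0 ≤ a)
    (hb : 0 ≤ b) (hc : 0 < c) (he : 0 < e) (hψ₁ : 0 < ψ₁) (hψ₂ : 0 < ψ₂) (hk0 : 0 < k)
    (htot : k * (p + q) = ψ₂) (hk : k ≤ 1) (ht1 : k * p ≤ 1 / 2) (ht2 : k * p ≤ ψ₂ / 2) :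
    F ^ 2 * ((c * (ψ₁ / (1 + c + a))) ^ 2 * (ψ₂ / 2) /
      ((2 * (1 + a * (ψ₁ / c))) ^ 2 * (ψ₂ * (3 * ψ₁ + 2)))) * (k * p)⁻¹ ≤
      reducedRisk a b c e F τ (k * p) (k * q) 0 p q := by
  have hp := h.p_pos ha hb hψ₁
  have hq := h.swap.p_pos hb ha hψ₂
  obtain ⟨D, hD⟩ : ∃ D, D = 1 + a * p + b * q := ⟨_, rfl⟩
  obtain ⟨w₁₂, hw12⟩ : ∃ w, w = a * p * (b * q) / D ^ 2 := ⟨_, rfl⟩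
  obtain ⟨w₁₃, hw13⟩ : ∃ w, w = c * p + a * p / D ^ 2 := ⟨_, rfl⟩
  obtain ⟨w₂₃, hw23⟩ : ∃ w, w = e * q + b * q / D ^ 2 := ⟨_, rfl⟩
  obtain ⟨t, ht⟩ : ∃ t, t = k * p := ⟨_, rfl⟩
  obtain ⟨s, hs⟩ : ∃ s, s = k * q := ⟨_, rfl⟩
  have htpos : 0 < t := by rw [ht]; positivity
  have hspos : 0 < s := by rw [hs]; positivity
  have e1 := h.eq₁
  have e2 := h.eq₂
  have hcp := h.c_mul_p_le ha hb
  have hpl := h.le_p ha hb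
  have hap : 0 ≤ a * p := by positivity
  have hbq : 0 ≤ b * q := by positivity
  have hD1 : 1 ≤ D := by rw [hD]; linarith
  have hDpos : 0 < D := by linarith
  rw [← hD, ← ht] at e1
  rw [← hD, ← hs] at e2
  rw [mul_add, ← ht, ← hs] at htot
  rw [← ht] at ht1 ht2
  have hd : 0 < lapDet t s 0 w₁₂ w₁₃ w₂₃ := by
    rw [hw12, hw13, hw23]
    exact h.lapDet_pos ha hb hc he hψ₁ hψ₂ htpos.le hspos.le le_rfl (by linarith)
  have hlow := le_reducedRisk (F := F) (τ := τ) ha hb hc.le he.le htpos.le hspos.le le_rfl hp.le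
    hq.le hD hw12 hw13 hw23 hd
  rw [← ht, ← hs]
  refine le_trans ?_ hlow
  rw [mul_assoc]
  apply mul_le_mul_of_nonneg_left _ (sq_nonneg F)
  -- The second equation and the total rate both equal `ψ₂`; their difference bounds `w₁₂` and `w₂₃`
  -- by `t`, which makes the determinant `O(t)`.
  have hεβ : e * q + b * q / D = t := by linarith
  have hβ0 : 0 ≤ b * q / D := by positivity
  have hα0 : 0 ≤ a * p / D := by positivity
  have hα1 : a * p / D ≤ 1 := by rw [div_le_one hDpos, hD]; linarith
  have hDsq : ∀ x : ℝ, 0 ≤ x → x / D ^ 2 ≤ x / D := by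
    intro x hx
    exact div_le_div_of_nonneg_left hx hDpos (by nlinarith)
  have heq : 0 < e * q := by positivity
  have hcp0 : 0 < c * p := by positivity
  have w12le : w₁₂ ≤ t := by
    have : w₁₂ = a * p / D * (b * q / D) := by rw [hw12]; field_simp
    rw [this]
    nlinarith
  have w13le : w₁₃ ≤ ψ₁ := by
    rw [hw13]; linarith [hDsq _ hap]
  have w23le : w₂₃ ≤ t := by
    rw [hw23]; linarith [hDsq _ hbq]
  have w12n : 0 ≤ w₁₂ := by rw [hw12]; positivity
  have w23n : 0 ≤ w₂₃ := by rw [hw23]; positivity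
  have w13ge : c * p ≤ w₁₃ := by rw [hw13]; linarith [div_nonneg hap (sq_nonneg D)]
  have w13n : 0 ≤ w₁₃ := hcp0.le.trans w13ge
  have hDle : D ≤ 2 * (1 + a * (ψ₁ / c)) := by
    have h1 : b * q ≤ 1 / 2 * D := by
      rw [← div_le_iff₀ hDpos]; linarith
    have h2 : a * p ≤ a * (ψ₁ / c) := by
      gcongr
      rw [le_div_iff₀ hc]; linarith
    linarith
  have hdet : lapDet t s 0 w₁₂ w₁₃ w₂₃ ≤ ψ₂ * (3 * ψ₁ + 2) * t := by
    have hsle : s ≤ ψ₂ := by linarith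
    have w12le' : w₁₂ ≤ 1 := by linarith
    have w23le' : w₂₃ ≤ 1 := by linarith
    have i1 : t * s * (w₁₃ + w₂₃) ≤ t * ψ₂ * (ψ₁ + 1) := by gcongr
    have i2 : w₁₂ * w₁₃ + w₁₂ * w₂₃ + w₁₃ * w₂₃ ≤ t * ψ₁ + t * 1 + ψ₁ * t := by gcongr
    have i3 := mul_le_mul_of_nonneg_left i2 hψ₂.le
    have : lapDet t s 0 w₁₂ w₁₃ w₂₃ = t * s * (w₁₃ + w₂₃) +
        (t + s) * (w₁₂ * w₁₃ + w₁₂ * w₂₃ + w₁₃ * w₂₃) := by unfold lapDet; ring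
    rw [this, htot]
    linarith
  have hg : c * (ψ₁ / (1 + c + a)) ≤ c * p := by
    gcongr
    rw [div_le_iff₀ (by positivity)]
    refine hpl.trans ?_
    gcongr
  have hnum : (c * (ψ₁ / (1 + c + a))) ^ 2 * (ψ₂ / 2) ≤ c * p * (w₁₃ * s + w₁₃ * w₂₃) := by
    have i1 : (c * (ψ₁ / (1 + c + a))) ^ 2 * (ψ₂ / 2) ≤ (c * p) ^ 2 * s := by
      gcongr
      linarith
    have i2 : c * p * (c * p * s) ≤ c * p * (w₁₃ * s) := by gcongr
    have i3 : 0 ≤ c * p * (w₁₃ * w₂₃) := by positivity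
    linarith
  calc _ = (c * (ψ₁ / (1 + c + a))) ^ 2 * (ψ₂ / 2) /
        ((2 * (1 + a * (ψ₁ / c))) ^ 2 * (ψ₂ * (3 * ψ₁ + 2) * t)) := by
        rw [div_mul_eq_mul_div, ← div_eq_mul_inv, div_div]
        congr 1; ring
    _ ≤ _ := by gcongr

end VanishingSecondActivation

section Risk

variable {P : DRFMParams}

lemma exists_reduced_fun (h1 : 0 < P.ψ₁) (h2 : 0 < P.ψ₂) (h3 : 0 < P.ψ₃) (hc : 0 < P.μ₁₂)
    (he : 0 < P.μ₂₂) (F τ : ℝ) :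
    ∃ t₁ t₂ t₃ p q : ℝ → ℝ, (∀ lam, 0 < lam → Reduced (P.μ₁₁ ^ 2) (P.μ₂₁ ^ 2) (P.μ₁₂ ^ 2)
        (P.μ₂₂ ^ 2) P.ψ₁ P.ψ₂ P.ψ₃ lam (t₁ lam) (t₂ lam) (t₃ lam) (p lam) (q lam)) ∧
      (fun lam => reducedRisk (P.μ₁₁ ^ 2) (P.μ₂₁ ^ 2) (P.μ₁₂ ^ 2) (P.μ₂₂ ^ 2) F τ
        (t₁ lam) (t₂ lam) (t₃ lam) (p lam) (q lam)) =ᶠ[𝓝[>] 0] P.risk F τ := by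
  have key := fun lam (hl : 0 < lam) => exists_reduced h1 h2 h3 hc he F τ hl
  choose! t₁ t₂ t₃ p q h using key
  refine ⟨t₁, t₂, t₃, p, q, fun lam hl => (h lam hl).1, ?_⟩
  filter_upwards [self_mem_nhdsWithin] with lam hl
  exact (h lam hl).2.symm

end Risk

end DRFMParams

/-! ### The four regimes -/

open DRFMParams

theorem proposition1 (ψ₁ ψ₂ ψ₃ : ℝ) (hψ₁ : 0 < ψ₁) (hψ₂ : 0 < ψ₂) (hψ₃ : 0 < ψ₃)
    (μ₁₁ μ₁₂ : ℝ) (hμ₁₂ : 0 < μ₁₂) (F₁ τ : ℝ) (hF₁ : 0 < F₁) :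
    -- below the interpolation threshold: finite ridgeless limit
    ((ψ₁ + ψ₂) / ψ₃ < 1 →
      ∀ μ₂₁ μ₂₂ : ℝ, 0 < μ₂₂ →
        ∃ l : ℝ, Tendsto
          (fun lam : ℝ => (DRFMParams.mk ψ₁ ψ₂ ψ₃ μ₁₁ μ₁₂ μ₂₁ μ₂₂).risk F₁ τ lam)
          (𝓝[>] 0) (𝓝 l)) ∧
    -- at the interpolation threshold: infinite ridgeless limit
    ((ψ₁ + ψ₂) / ψ₃ = 1 →
      ∀ μ₂₁ μ₂₂ : ℝ, 0 < μ₂₂ →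
        Tendsto
          (fun lam : ℝ => (DRFMParams.mk ψ₁ ψ₂ ψ₃ μ₁₁ μ₁₂ μ₂₁ μ₂₂).risk F₁ τ lam)
          (𝓝[>] 0) atTop) ∧
    -- between the two thresholds: the lower limit of the ridgeless risk is finite
    (1 < (ψ₁ + ψ₂) / ψ₃ → (ψ₁ + ψ₂) / ψ₃ < 1 + ψ₂ / ψ₁ →
      ∃ R₀ : ℝ → ℝ → ℝ,
        (∀ μ₂₁ μ₂₂ : ℝ, 0 < μ₂₂ →
          Tendsto
            (fun lam : ℝ => (DRFMParams.mk ψ₁ ψ₂ ψ₃ μ₁₁ μ₁₂ μ₂₁ μ₂₂).risk F₁ τ lam)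
            (𝓝[>] 0) (𝓝 (R₀ μ₂₁ μ₂₂))) ∧
        liminf (fun m : ℝ × ℝ => ((R₀ m.1 m.2 : ℝ) : EReal)) (𝓝 0 ×ˢ 𝓝[>] 0) < ⊤) ∧
    -- at the second threshold: the ridgeless risk diverges
    ((ψ₁ + ψ₂) / ψ₃ = 1 + ψ₂ / ψ₁ →
      ∃ R₀ : ℝ → ℝ → ℝ,
        (∀ μ₂₁ μ₂₂ : ℝ, 0 < μ₂₂ →
          Tendsto
            (fun lam : ℝ => (DRFMParams.mk ψ₁ ψ₂ ψ₃ μ₁₁ μ₁₂ μ₂₁ μ₂₂).risk F₁ τ lam)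
            (𝓝[>] 0) (𝓝 (R₀ μ₂₁ μ₂₂))) ∧
        Tendsto (fun m : ℝ × ℝ => R₀ m.1 m.2) (𝓝 0 ×ˢ 𝓝[>] 0) atTop) := by
  have ha := sq_nonneg μ₁₁
  have hc := pow_pos hμ₁₂ 2
  have hratio : 1 + ψ₂ / ψ₁ = (ψ₁ + ψ₂) / ψ₁ := by field_simp
  have hover : ψ₃ < ψ₁ + ψ₂ → ∃ R₀ k p q : ℝ → ℝ → ℝ, ∀ μ₂₁ μ₂₂ : ℝ, 0 < μ₂₂ →
      Tendsto (fun lam : ℝ => (DRFMParams.mk ψ₁ ψ₂ ψ₃ μ₁₁ μ₁₂ μ₂₁ μ₂₂).risk F₁ τ lam)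
        (𝓝[>] 0) (𝓝 (R₀ μ₂₁ μ₂₂)) ∧ 0 < k μ₂₁ μ₂₂ ∧
      Balance (μ₁₁ ^ 2) (μ₂₁ ^ 2) (μ₁₂ ^ 2) (μ₂₂ ^ 2) ψ₁ ψ₂ (k μ₂₁ μ₂₂) (p μ₂₁ μ₂₂) (q μ₂₁ μ₂₂) ∧
      k μ₂₁ μ₂₂ * (p μ₂₁ μ₂₂ + q μ₂₁ μ₂₂) = ψ₁ + ψ₂ - ψ₃ ∧
      R₀ μ₂₁ μ₂₂ = reducedRisk (μ₁₁ ^ 2) (μ₂₁ ^ 2) (μ₁₂ ^ 2) (μ₂₂ ^ 2) F₁ τ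
        (k μ₂₁ μ₂₂ * p μ₂₁ μ₂₂) (k μ₂₁ μ₂₂ * q μ₂₁ μ₂₂) 0 (p μ₂₁ μ₂₂) (q μ₂₁ μ₂₂) := by
    intro hψ
    have key : ∀ μ₂₁ μ₂₂ : ℝ, ∃ R₀ k p q : ℝ, 0 < μ₂₂ →
        Tendsto (fun lam : ℝ => (DRFMParams.mk ψ₁ ψ₂ ψ₃ μ₁₁ μ₁₂ μ₂₁ μ₂₂).risk F₁ τ lam)
          (𝓝[>] 0) (𝓝 R₀) ∧ 0 < k ∧
        Balance (μ₁₁ ^ 2) (μ₂₁ ^ 2) (μ₁₂ ^ 2) (μ₂₂ ^ 2) ψ₁ ψ₂ k p q ∧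
        k * (p + q) = ψ₁ + ψ₂ - ψ₃ ∧
        R₀ = reducedRisk (μ₁₁ ^ 2) (μ₂₁ ^ 2) (μ₁₂ ^ 2) (μ₂₂ ^ 2) F₁ τ (k * p) (k * q) 0 p q := by
      intro μ₂₁ μ₂₂
      by_cases hμ : 0 < μ₂₂
      · obtain ⟨t₁, t₂, t₃, p, q, hr, heq⟩ := exists_reduced_fun
          (P := DRFMParams.mk ψ₁ ψ₂ ψ₃ μ₁₁ μ₁₂ μ₂₁ μ₂₂) hψ₁ hψ₂ hψ₃ hμ₁₂ hμ F₁ τ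
        obtain ⟨k, p₀, q₀, hk, hbal, htot, hlim⟩ := tendsto_over (F := F₁) (τ := τ) ha
          (sq_nonneg μ₂₁) hc (pow_pos hμ 2) hψ₁ hψ₂ hψ₃ hψ hr
        exact ⟨_, k, p₀, q₀, fun _ => ⟨hlim.congr' heq, hk, hbal, htot, rfl⟩⟩
      -- Arbitrary values for `μ₂₂ ≤ 0`, which the filter `𝓝[>] 0` never sees.
      · exact ⟨0, 0, 0, 0, fun h => (hμ h).elim⟩
    choose R₀ k p q h using key
    exact ⟨R₀, k, p, q, h⟩
  refine ⟨?_, ?_, ?_, ?_⟩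
  · intro hψ μ₂₁ μ₂₂ hμ
    rw [div_lt_one hψ₃] at hψ
    obtain ⟨t₁, t₂, t₃, p, q, hr, heq⟩ := exists_reduced_fun
      (P := DRFMParams.mk ψ₁ ψ₂ ψ₃ μ₁₁ μ₁₂ μ₂₁ μ₂₂) hψ₁ hψ₂ hψ₃ hμ₁₂ hμ F₁ τ
    obtain ⟨p₀, q₀, hbal, hp, hq, h1, h2, h3⟩ := tendsto_under ha (sq_nonneg μ₂₁) hc
      (pow_pos hμ 2) hψ₁ hψ₂ hψ.le hr
    refine ⟨_, Tendsto.congr' heq (tendsto_reducedRisk h1 h2 h3 hp hq rfl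
      (hbal.den_pos ha (sq_nonneg _)).ne' ?_)⟩
    exact (hbal.lapDet_pos ha (sq_nonneg _) hc (pow_pos hμ 2) hψ₁ hψ₂ le_rfl le_rfl
      (by linarith) (by linarith)).ne'
  · intro hψ μ₂₁ μ₂₂ hμ
    rw [div_eq_one_iff_eq hψ₃.ne'] at hψ
    obtain ⟨t₁, t₂, t₃, p, q, hr, heq⟩ := exists_reduced_fun
      (P := DRFMParams.mk ψ₁ ψ₂ ψ₃ μ₁₁ μ₁₂ μ₂₁ μ₂₂) hψ₁ hψ₂ hψ₃ hμ₁₂ hμ F₁ τ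
    exact (tendsto_threshold hF₁ ha (sq_nonneg _) hc (pow_pos hμ 2) hψ₁ hψ₂ hψ hr).congr' heq
  · intro hψ hψ'
    rw [one_lt_div hψ₃] at hψ
    rw [hratio, div_lt_div_iff_of_pos_left (by positivity) hψ₃ hψ₁] at hψ'
    obtain ⟨R₀, k, p, q, h⟩ := hover hψ
    refine ⟨R₀, fun μ₂₁ μ₂₂ hμ => (h μ₂₁ μ₂₂ hμ).1, ?_⟩
    obtain ⟨C, hC⟩ := exists_reducedRisk_le (F := F₁) (τ := τ) ha hc hψ₁ hψ₂ hψ' hψ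
    -- A lower limit is bounded by values attained frequently, so the curve `μ₂₁ = 0`, `μ₂₂ → 0⁺`
    -- suffices.
    have hT : Tendsto (fun μ : ℝ => ((0 : ℝ), μ)) (𝓝[>] 0) (𝓝 0 ×ˢ 𝓝[>] 0) :=
      tendsto_const_nhds.prodMk tendsto_id
    have hfreq : ∃ᶠ m : ℝ × ℝ in 𝓝 0 ×ˢ 𝓝[>] 0, ((R₀ m.1 m.2 : ℝ) : EReal) ≤ (C : EReal) := by
      refine hT.frequently (Eventually.frequently ?_)
      filter_upwards [self_mem_nhdsWithin, mem_nhdsWithin_of_mem_nhds (gt_mem_nhds one_pos)]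
        with μ hμ hμ1
      have hμ : 0 < μ := hμ
      have hμ1 : μ < 1 := hμ1
      obtain ⟨-, -, hbal, htot, hR⟩ := h 0 μ hμ
      rw [EReal.coe_le_coe_iff, hR]
      rw [zero_pow two_ne_zero] at hbal ⊢
      exact hC _ _ _ _ (pow_pos hμ 2) (pow_le_one₀ hμ.le hμ1.le) hbal htot
    exact (liminf_le_of_frequently_le hfreq).trans_lt (EReal.coe_lt_top C)
  · intro hψ
    rw [hratio, div_eq_div_iff hψ₃.ne' hψ₁.ne'] at hψ
    -- The second threshold is the case `ψ₃ = ψ₁`, in which the total rate `ψ₁ + ψ₂ - ψ₃` equals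
    -- `ψ₂`.
    obtain rfl : ψ₃ = ψ₁ := (mul_left_cancel₀ (by positivity) hψ).symm
    obtain ⟨R₀, k, p, q, h⟩ := hover (by linarith)
    refine ⟨R₀, fun μ₂₁ μ₂₂ hμ => (h μ₂₁ μ₂₂ hμ).1, ?_⟩
    set l : Filter (ℝ × ℝ) := 𝓝 0 ×ˢ 𝓝[>] 0
    have hpos : ∀ᶠ m : ℝ × ℝ in l, 0 < m.2 :=
      tendsto_snd.eventually (self_mem_nhdsWithin : Set.Ioi (0 : ℝ) ∈ 𝓝[>] 0)
    have h1 : Tendsto (fun m : ℝ × ℝ => m.1) l (𝓝 0) := tendsto_fst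
    have h2 : Tendsto (fun m : ℝ × ℝ => m.2) l (𝓝 0) := tendsto_snd.mono_right nhdsWithin_le_nhds
    obtain ⟨C, hC⟩ : ∃ C, C = ψ₂ * (1 + μ₁₂ ^ 2 + μ₁₁ ^ 2) / ψ₃ := ⟨_, rfl⟩
    have hρ : Tendsto (fun m : ℝ × ℝ => (m.1 ^ 2 + m.2 ^ 2) * C) l (𝓝 0) := by
      simpa using ((h1.pow 2).add (h2.pow 2)).mul_const C
    have hρs : Tendsto (fun m : ℝ × ℝ => Real.sqrt ((m.1 ^ 2 + m.2 ^ 2) * C)) l (𝓝 0) := by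
      simpa [Function.comp_def] using (Real.continuous_sqrt.tendsto _).comp hρ
    have hk : Tendsto (fun m : ℝ × ℝ => k m.1 m.2) l (𝓝 0) := by
      refine squeeze_zero' (hpos.mono fun m hm => (h m.1 m.2 hm).2.1.le) ?_ hρs
      filter_upwards [hpos, hρ.eventually (gt_mem_nhds one_pos)] with m hm hm1
      obtain ⟨-, -, hbal, htot, -⟩ := h m.1 m.2 hm
      exact hbal.rate_le ha (sq_nonneg _) hc (pow_pos hm 2) hψ₃ hψ₂ (by linarith) hC hm1.le
    have hkp0 : ∀ᶠ m in l, 0 < k m.1 m.2 * p m.1 m.2 := by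
      filter_upwards [hpos] with m hm
      obtain ⟨-, hk0, hbal, -, -⟩ := h m.1 m.2 hm
      exact mul_pos hk0 (hbal.p_pos ha (sq_nonneg _) hψ₃)
    have hkp : Tendsto (fun m : ℝ × ℝ => k m.1 m.2 * p m.1 m.2) l (𝓝 0) := by
      have hup : Tendsto (fun m : ℝ × ℝ => k m.1 m.2 * (ψ₃ / μ₁₂ ^ 2)) l (𝓝 0) := by
        simpa using hk.mul_const (ψ₃ / μ₁₂ ^ 2)
      refine squeeze_zero' (hkp0.mono fun m hm => hm.le) ?_ hup
      filter_upwards [hpos] with m hm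
      obtain ⟨-, hk0, hbal, -, -⟩ := h m.1 m.2 hm
      gcongr
      rw [le_div_iff₀ hc]
      linarith [hbal.c_mul_p_le ha (sq_nonneg _)]
    have hinv : Tendsto (fun m : ℝ × ℝ => (k m.1 m.2 * p m.1 m.2)⁻¹) l atTop :=
      tendsto_inv_nhdsGT_zero.comp (tendsto_nhdsWithin_iff.2 ⟨hkp, hkp0⟩)
    refine tendsto_atTop_mono' l ?_ (hinv.const_mul_atTop (r := F₁ ^ 2 *
      ((μ₁₂ ^ 2 * (ψ₃ / (1 + μ₁₂ ^ 2 + μ₁₁ ^ 2))) ^ 2 * (ψ₂ / 2) /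
      ((2 * (1 + μ₁₁ ^ 2 * (ψ₃ / μ₁₂ ^ 2))) ^ 2 * (ψ₂ * (3 * ψ₃ + 2))))) (by positivity))
    filter_upwards [hpos, hk.eventually (gt_mem_nhds one_pos),
      hkp.eventually (gt_mem_nhds one_half_pos), hkp.eventually (gt_mem_nhds (half_pos hψ₂))]
      with m hm hm1 hm2 hm3
    obtain ⟨-, hk0, hbal, htot, hR⟩ := h m.1 m.2 hm
    rw [hR]
    exact le_reducedRisk_second_threshold hbal ha (sq_nonneg _) hc (pow_pos hm 2) hψ₃ hψ₂ hk0
      (by linarith) hm1.le hm2.le hm3.le
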